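/- Let $\theta,\theta_0>0$ and let $V$ nodes be divided into $d$ layers, layer $j$ containing $V_j$ nodes. Let $({\bf z},{\bf w})$ be the group and subgroup allocations generated by the hierarchical Dirichlet process with concentration parameters $\theta,\theta_0$ as follows. Let $\mathbb T,\mathbb X$ be Polish spaces, $G_1,\dots,G_d$ diffuse probability measures on $\mathbb T$ and $P_0$ a diffuse probability measure on $\mathbb X$. (i) Independently for each layer $j$, let $\tilde Q_j\sim\mathrm{DP}(\theta,G_j)$ and, given $\tilde Q_j$, let the labels $t_v$ of the nodes $v$ of layer $j$ be iid from $\tilde Q_j$; two nodes of the same layer are in the same subgroup iff their labels coincide, and $w_v\in\{1,2,\dots\}$ is the index of the subgroup of $v$, the subgroups of each layer being numbered in order of appearance. (ii) Independently of step (i), let $\tilde P_0\sim\mathrm{DP}(\theta_0,P_0)$ and, given $\tilde P_0$, let $s_{j\tau}$ ($1\le j\le d$, $\tau\ge1$) be iid from $\tilde P_0$. (iii) For $v$ in layer $j$ put $x_v=s_{j w_v}$; two nodes are in the same group iff $x_v=x_u$, and $z_v\in\{1,2,\dots\}$ is the index of the group of $v$, the groups being numbered in order of appearance in the whole network. Let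 $v\ne u$ be two nodes, and let ${\bf z}^{-vu},{\bf w}^{-vu}$ be the allocation vectors with $v,u$ removed and the labels renumbered in order of appearance. Disregarding $v$ and $u$, let $H^{-vu}$ be the number of groups, $n_{jh}^{-vu}$ the number of nodes of layer $j$ in group $h$, $\ell_{\cdot h}^{-vu}$ the number of subgroups, over all layers, contained in group $h$, and $|\boldsymbol\ell^{-vu}|=\sum_h\ell_{\cdot h}^{-vu}$. Then, on every value of $({\bf z}^{-vu},{\bf w}^{-vu})$ of positive probability, the following holds. If $v$ and $u$ are both in layer $j$, $$\begin{aligned}\mathbb P(z_v=z_u\mid{\bf z}^{-vu},{\bf w}^{-vu})=\frac{1}{(\theta+V_j-2)(\theta+V_j-1)}\Bigg[&\sum_{h=1}^{H^{-vu}}n_{jh}^{-vu}(n_{jh}^{-vu}+1)+\theta\Bigg(1+\frac{2}{\theta_0+|\boldsymbol\ell^{-vu}|}\sum_{h=1}^{H^{-vu}}n_{jh}^{-vu}\ell_{\cdot h}^{-vu}\Bigg)\\&+\frac{\theta^2}{(\theta_0+|\boldsymbol\ell^{-vu}|)(\theta_0+|\boldsymbol\ell^{-vu}|+1)}\Bigg(\sum_{h=1}^{H^{-vu}}\ell_{\cdot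 h}^{-vu}(\ell_{\cdot h}^{-vu}+1)+\theta_0\Bigg)\Bigg].\end{aligned}$$ If $v$ is in layer $j$ and $u$ is in layer $j'\neq j$, $$\begin{aligned}\mathbb P(z_v=z_u\mid{\bf z}^{-vu},{\bf w}^{-vu})=\frac{1}{(\theta+V_j-1)(\theta+V_{j'}-1)}\Bigg[&\sum_{h=1}^{H^{-vu}}n_{jh}^{-vu}n_{j'h}^{-vu}+\frac{\theta}{\theta_0+|\boldsymbol\ell^{-vu}|}\sum_{h=1}^{H^{-vu}}\ell_{\cdot h}^{-vu}\big(n_{jh}^{-vu}+n_{j'h}^{-vu}\big)\\&+\frac{\theta^2}{(\theta_0+|\boldsymbol\ell^{-vu}|)(\theta_0+|\boldsymbol\ell^{-vu}|+1)}\Bigg(\sum_{h=1}^{H^{-vu}}\ell_{\cdot h}^{-vu}(\ell_{\cdot h}^{-vu}+1)+\theta_0\Bigg)\Bigg].\end{aligned}$$ -/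

import Mathlib

open MeasureTheory ProbabilityTheory

noncomputable section

/-- The gamma law with shape `a` and unit rate, with the usual convention that shape `0`
is the unit mass at `0`. -/
def gammaLaw (a : ℝ) : Measure ℝ :=
  open Classical in if 0 < a then gammaMeasure a 1 else Measure.dirac 0

/-- The Dirichlet law with parameters `a` (some of which may vanish): the law of a vector of
independent unit-rate gamma variables with shapes `a i`, divided by its sum. -/
def dirichletLaw {k : ℕ} (a : Fin k → ℝ) : Measure (Fin k → ℝ) :=
  (Measure.pi fun i => gammaLaw (a i)).map fun g i => g i / ∑ l, g l

/-- The random probability measure `P` is a Dirichlet process with concentration parameter `θ`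
and base probability measure `G`: on every finite measurable partition of the space its values
are Dirichlet distributed, with parameters `θ` times the `G`-masses of the blocks. -/
def IsDirichletProcess {Ω α : Type*} [MeasurableSpace Ω] [MeasurableSpace α]
    (μ : Measure Ω) (θ : ℝ) (G : Measure α) (P : Kernel Ω α) : Prop :=
  ∀ (k : ℕ) (A : Fin k → Set α), (∀ i, MeasurableSet (A i)) →
    (Pairwise fun i l => Disjoint (A i) (A l)) → (⋃ i, A i) = Set.univ →
    μ.map (fun ω i => (P ω).real (A i)) = dirichletLaw fun i => θ * G.real (A i)

/-- Conditionally on the random probability measure `P`, the variables `y i` are independent with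
common law `P`. -/
def IsCondIID {Ω α ι : Type*} [MeasurableSpace Ω] [MeasurableSpace α]
    (μ : Measure Ω) (P : Kernel Ω α) (y : ι → Ω → α) : Prop :=
  ∀ (S : Finset ι) (B : ι → Set α), (∀ i, MeasurableSet (B i)) →
    ∀ C : Set (Measure α), MeasurableSet C →
      μ {ω | P ω ∈ C ∧ ∀ i ∈ S, y i ω ∈ B i} = ∫⁻ ω in {ω | P ω ∈ C}, ∏ i ∈ S, P ω (B i) ∂μ

/-- `P` is a Dirichlet process with parameters `θ, G`, and `y` is an iid sample from `P`. -/
structure IsDPSample {Ω α ι : Type*} [MeasurableSpace Ω] [MeasurableSpace α]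
    (μ : Measure Ω) (θ : ℝ) (G : Measure α) (P : Kernel Ω α) (y : ι → Ω → α) : Prop where
  measurable : ∀ i, Measurable (y i)
  isDirichletProcess : IsDirichletProcess μ θ G P
  isCondIID : IsCondIID μ P y

/-- Two-level sampling scheme of the hierarchical Dirichlet process with parameters `θ, θ₀`, for
`N` nodes divided into `d` layers by `lay`.

* In each layer `j`, the subgroup labels `t v` of the nodes `v` of that layer are an iid sample
  from a Dirichlet process `Q j` with parameters `θ, G j`.
* The profile labels `s (j, τ)` (for the `τ`-th subgroup of layer `j`) are an iid sample from a
  Dirichlet process `P` with parameters `θ₀, P₀`, shared by all layers.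
* The layers are independent of each other, and of the assignment of profiles. -/
structure IsHDPScheme {Ω T X : Type*} [MeasurableSpace Ω] [MeasurableSpace T] [MeasurableSpace X]
    {N d : ℕ} (μ : Measure Ω) (lay : Fin N → Fin d) (θ θ₀ : ℝ)
    (G : Fin d → Measure T) (P₀ : Measure X)
    (Q : Fin d → Kernel Ω T) (P : Kernel Ω X)
    (t : Fin N → Ω → T) (s : Fin d × ℕ → Ω → X) : Prop where
  subgroups : ∀ j, IsDPSample μ θ (G j) (Q j) (fun v : {v // lay v = j} => t v)
  profiles : IsDPSample μ θ₀ P₀ P s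
  indep_layers :
    iIndepFun (fun j ω => ((Q j ω : Measure T), fun v : {v // lay v = j} => t v ω)) μ
  indep_levels :
    IndepFun (fun ω => (fun j => (Q j ω : Measure T), fun v => t v ω))
      (fun ω => ((P ω : Measure X), fun p => s p ω)) μ

/-- The label (`1, 2, …`) of the value `f a` when the distinct values of `f` on `S` are numbered
in order of appearance: the number of first appearances of a value in `S` up to and including the
first appearance of `f a`. -/
def appearanceLabel {ι β : Type*} [LinearOrder ι] (S : Finset ι) (f : ι → β) (a : ι) : ℕ :=
  open Classical in
  (S.filter fun b => (∀ c ∈ S, c < b → f c ≠ f b) ∧ ∀ c ∈ S, f c = f a → b ≤ c).card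

/-- Subgroup allocations `w`: ties of `t` within each layer, numbered in order of appearance. -/
def subgroupAlloc {N d : ℕ} {T : Type*} (lay : Fin N → Fin d) (t : Fin N → T) (v : Fin N) : ℕ :=
  appearanceLabel (Finset.univ.filter fun a => lay a = lay v) t v

/-- The latent attribute of a node: the profile label of its subgroup. -/
def latentAttr {N d : ℕ} {T X : Type*} (lay : Fin N → Fin d) (t : Fin N → T)
    (s : Fin d × ℕ → X) (v : Fin N) : X :=
  s (lay v, subgroupAlloc lay t v)

/-- Group allocations `z`: ties of the latent attributes over the whole network, numbered in order
of appearance. -/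
def groupAlloc {N d : ℕ} {T X : Type*} (lay : Fin N → Fin d) (t : Fin N → T)
    (s : Fin d × ℕ → X) (v : Fin N) : ℕ :=
  appearanceLabel Finset.univ (latentAttr lay t s) v

/-- The nodes other than `v` and `u`. -/
abbrev others {N : ℕ} (v u : Fin N) : Finset (Fin N) := {v, u}ᶜ

/-- `z⁻ᵛᵘ`: remove the nodes `v, u` and renumber the groups in order of appearance. -/
def removeZ {N : ℕ} (v u : Fin N) (z : Fin N → ℕ) (a : others v u) : ℕ :=
  appearanceLabel (others v u) z a

/-- `w⁻ᵛᵘ`: remove the nodes `v, u` and renumber the subgroups of each layer in order of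
appearance. -/
def removeW {N d : ℕ} (lay : Fin N → Fin d) (v u : Fin N) (w : Fin N → ℕ) (a : others v u) : ℕ :=
  appearanceLabel ((others v u).filter fun b => lay b = lay a) w a

/-- `V_j`: the number of nodes in layer `j`. -/
def layerSize {N d : ℕ} (lay : Fin N → Fin d) (j : Fin d) : ℕ :=
  (Finset.univ.filter fun a => lay a = j).card

section Counts

variable {N d : ℕ} {S : Finset (Fin N)}

/-- `H`: the number of groups. -/
def numGroups (z : S → ℕ) : ℕ := (Finset.univ.image z).card

/-- `n_{jh}`: the number of nodes in layer `j` allocated to group `h`. -/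
def nodeCount (lay : Fin N → Fin d) (z : S → ℕ) (j : Fin d) (h : ℕ) : ℕ :=
  (Finset.univ.filter fun a : S => lay a = j ∧ z a = h).card

/-- `ℓ_{jh}`: the number of subgroups in layer `j` made of nodes allocated to group `h`. -/
def subgroupCount (lay : Fin N → Fin d) (z w : S → ℕ) (j : Fin d) (h : ℕ) : ℕ :=
  ((Finset.univ.filter fun a : S => lay a = j ∧ z a = h).image w).card

/-- `ℓ_{·h}`: the number of subgroups, in all layers, with profile `h`. -/
def subgroupTotal (lay : Fin N → Fin d) (z w : S → ℕ) (h : ℕ) : ℕ :=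
  ∑ j, subgroupCount lay z w j h

/-- `|ℓ|`: the total number of subgroups. -/
def subgroupCard (lay : Fin N → Fin d) (z w : S → ℕ) : ℕ :=
  ∑ j, ∑ h ∈ Finset.Icc 1 (numGroups z), subgroupCount lay z w j h

end Counts

end

/-! ### Moments of gamma and Dirichlet laws. -/

noncomputable section

/-! Once its random measure is integrated out, a sample from a Dirichlet process is a
Blackwell–MacQueen urn: given k other draws, a draw copies each of them with weight 1 and is fresh
from the base measure with weight θ, out of a total θ + k. This follows from the moments of
Dirichlet vectors (`lintegral_dirichletLaw_mul`), passes to a layered sample by independence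
(`isUrnSample_of_layers`), and is used as the integration rule `IsUrnSample.lintegral`. The rule
holds for any index outside the conditioning set, so v and u may be taken as the last two draws.

The two levels are independent, so the labels t can be frozen while the profiles s are averaged
(`IsHDPScheme.measure_eq_lintegral`). Adding v and then u to the labels leaves the following cases
(`IsUrnSample.lintegral_two_nodes`). If both join old subgroups, they tie iff these lie in the same
group. If one joins an old subgroup of group h and the other opens a new one, the new profile falls
in h with probability ℓ_h / (θ₀ + |ℓ|). If u copies v, they tie surely. If they open two distinct
new subgroups, the two profiles tie with probability (θ₀ + |ℓ| + ∑ ℓ_h²) / ((θ₀ + |ℓ|)(θ₀ + |ℓ| +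
1)). The profile probabilities come from the upper urn (`IsUrnSample.measure_tiePattern_tie`,
`IsUrnSample.measure_tiePattern_tie_new`); diffuse base measures ensure that fresh draws create no
ties.

One point is delicate: the subgroup numbers of the remaining nodes depend on the labels of v and u.
Exchangeability of the profiles makes this harmless (`IsCondIID.measure_tiePattern_congr`), since
only the ties among the numbers matter. All identities are kept multiplied out, as joint
probabilities; `IsHDPScheme.measure_pattern_tie` collects them, and division by the probability of
the conditioning event comes last. -/

open Real in
theorem lintegral_rpow_mul_exp_neg_mul_Ioi {a r : ℝ} (ha : 0 < a) (hr : 0 < r) :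
    ∫⁻ x in Set.Ioi (0 : ℝ), ENNReal.ofReal (x ^ (a - 1) * exp (-(r * x)))
      = ENNReal.ofReal (Gamma a / r ^ a) := by
  have h := lintegral_gammaPDF_eq_one ha hr
  have h0 : ∫⁻ x in Set.Iic 0, gammaPDF a r x = 0 := by
    rw [setLIntegral_congr Iio_ae_eq_Iic.symm]
    exact lintegral_gammaPDF_of_nonpos le_rfl
  rw [← lintegral_add_compl _ (measurableSet_Iic (a := (0 : ℝ))), h0, zero_add, Set.compl_Iic] at h
  have hG := Gamma_pos_of_pos ha
  have hc : 0 < Gamma a / r ^ a := by positivity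
  rw [← mul_one (ENNReal.ofReal _), ← h, ← lintegral_const_mul' _ _ ENNReal.ofReal_ne_top]
  refine setLIntegral_congr_fun measurableSet_Ioi fun x hx => ?_
  rw [gammaPDF_of_nonneg (le_of_lt hx), ← ENNReal.ofReal_mul hc.le]
  congr 1
  have : r ^ a ≠ 0 := by positivity
  field_simp

theorem Gamma_add_natCast_eq_ascPochhammer {a : ℝ} (ha : 0 < a) (m : ℕ) :
    Real.Gamma (a + m) = (ascPochhammer ℝ m).eval a * Real.Gamma a := by
  induction m with
  | zero => simp
  | succ m ih =>
    have : a + m ≠ 0 := by positivity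
    rw [ascPochhammer_succ_eval, Nat.cast_succ, ← add_assoc, Real.Gamma_add_one this, ih]
    ring

theorem ascPochhammer_eval_nonneg {a : ℝ} (ha : 0 ≤ a) (m : ℕ) :
    0 ≤ (ascPochhammer ℝ m).eval a := by
  induction m with
  | zero => simp
  | succ m ih =>
    rw [ascPochhammer_succ_eval]
    positivity

theorem isProbabilityMeasure_gammaLaw (a : ℝ) : IsProbabilityMeasure (gammaLaw a) := by
  unfold gammaLaw
  split_ifs with h
  · exact isProbabilityMeasure_gammaMeasure h one_pos
  · infer_instance

theorem gammaLaw_ae_nonneg (a : ℝ) : ∀ᵐ x ∂gammaLaw a, 0 ≤ x := by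
  unfold gammaLaw
  split_ifs with h
  · rw [gammaMeasure, ae_withDensity_iff (by unfold gammaPDF; fun_prop)]
    refine ae_of_all _ fun x hx => ?_
    by_contra hneg
    exact hx (gammaPDF_of_neg (not_le.mp hneg))
  · simp [ae_dirac_eq]

theorem gammaLaw_ae_pos {a : ℝ} (ha : 0 < a) : ∀ᵐ x ∂gammaLaw a, 0 < x := by
  have h0 : ∀ᵐ x ∂gammaLaw a, x ≠ 0 := by
    rw [gammaLaw, if_pos ha, gammaMeasure]
    exact (withDensity_absolutelyContinuous _ _).ae_le (Measure.ae_ne volume 0)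
  filter_upwards [gammaLaw_ae_nonneg a, h0] with x h1 h2 using lt_of_le_of_ne h1 h2.symm

/-- Weighting the gamma density of shape a by x^m e^{-cx} gives a multiple of the gamma density with
shape a + m and rate 1 + c. In the degenerate case a = 0 both sides vanish unless m = 0. -/
theorem lintegral_pow_mul_exp_gammaLaw {a c : ℝ} (ha : 0 ≤ a) (hc : 0 ≤ c) (m : ℕ) :
    ∫⁻ x, ENNReal.ofReal x ^ m * ENNReal.ofReal (Real.exp (-(c * x))) ∂gammaLaw a
      = ENNReal.ofReal ((ascPochhammer ℝ m).eval a * (1 + c) ^ (-(a + m))) := by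
  unfold gammaLaw
  split_ifs with h
  · have hm : Measurable (gammaPDF a 1) := by unfold gammaPDF; fun_prop
    have hpos : 0 ≤ (ascPochhammer ℝ m).eval a * (1 + c) ^ (-(a + m)) :=
      mul_nonneg (ascPochhammer_eval_nonneg ha m) (by positivity)
    rw [gammaMeasure, lintegral_withDensity_eq_lintegral_mul _ hm (by fun_prop)]
    rw [← mul_one (ENNReal.ofReal _),
      ← lintegral_gammaPDF_eq_one (a := a + m) (r := 1 + c) (by positivity) (by positivity),
      ← lintegral_const_mul' _ _ ENNReal.ofReal_ne_top]
    refine lintegral_congr_ae ?_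
    filter_upwards [Measure.ae_ne volume (0 : ℝ)] with x hx
    rcases lt_or_gt_of_ne hx with hx | hx
    · simp [gammaPDF_of_neg hx]
    · simp only [Pi.mul_apply]
      rw [gammaPDF_of_nonneg hx.le, gammaPDF_of_nonneg hx.le, ← ENNReal.ofReal_pow hx.le,
        ← ENNReal.ofReal_mul (by positivity), ← ENNReal.ofReal_mul, ← ENNReal.ofReal_mul hpos]
      · congr 1
        have hG := (Real.Gamma_pos_of_pos h).ne'
        have hasc : (ascPochhammer ℝ m).eval a ≠ 0 := (ascPochhammer_pos m a h).ne'
        rw [Gamma_add_natCast_eq_ascPochhammer h, Real.one_rpow,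
          show a + (m : ℝ) - 1 = (a - 1) + m by ring, Real.rpow_add hx, Real.rpow_natCast,
          show -(1 * x) = -((1 + c) * x) + c * x by ring, Real.exp_add,
          Real.rpow_neg (by positivity), Real.exp_neg (c * x)]
        have h1 : (1 + c) ^ (a + (m : ℝ)) ≠ 0 := by positivity
        have h2 := (Real.exp_pos (c * x)).ne'
        field_simp
      · have := Real.Gamma_pos_of_pos h
        positivity
  · have ha0 : a = 0 := le_antisymm (not_lt.mp h) ha
    subst ha0
    rw [lintegral_dirac' _ (by fun_prop)]
    rcases m with _ | m
    · simp
    · simp [ascPochhammer_ne_zero_eval_zero]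

/-- The factor contributed to the moments of order `n` of a Dirichlet vector by the total mass. -/
def dirichletNormalizer (A : ℝ) (n : ℕ) : ENNReal :=
  (ENNReal.ofReal (Real.Gamma n))⁻¹ * ∫⁻ c in Set.Ioi (0 : ℝ),
    ENNReal.ofReal (c ^ ((n : ℝ) - 1)) * ENNReal.ofReal ((1 + c) ^ (-(A + n)))

/-- The gamma integral writes S^{-n} as Γ(n)⁻¹ ∫ c^{n-1} e^{-cS} dc. This replaces the common
denominator S = ∑ g l by a factor that splits over the coordinates, so that independence can be used
for each c. -/
theorem prod_ofReal_div_sum_pow {k : ℕ} {g : Fin k → ℝ} (hg : ∀ i, 0 ≤ g i) (m : Fin k → ℕ)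
    (hm : 0 < ∑ i, m i) :
    ∏ i, ENNReal.ofReal (g i / ∑ l, g l) ^ m i
      = (ENNReal.ofReal (Real.Gamma (∑ i, m i : ℕ)))⁻¹ * ∫⁻ c in Set.Ioi (0 : ℝ),
        ENNReal.ofReal (c ^ (((∑ i, m i : ℕ) : ℝ) - 1)) *
          ∏ i, (ENNReal.ofReal (g i) ^ m i * ENNReal.ofReal (Real.exp (-(c * g i)))) := by
  have hn : (0 : ℝ) < (∑ i, m i : ℕ) := by exact_mod_cast hm
  have hS : 0 ≤ ∑ l, g l := Finset.sum_nonneg fun l _ => hg l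
  rcases hS.eq_or_lt with hS | hS
  -- Here the quotients are 0/0 = 0, and both sides vanish because some exponent is positive.
  · have hz : ∀ i, g i = 0 := fun i =>
      (Finset.sum_eq_zero_iff_of_nonneg fun l _ => hg l).1 hS.symm i (Finset.mem_univ i)
    obtain ⟨i, -, hi⟩ := Finset.exists_ne_zero_of_sum_ne_zero hm.ne'
    have hprod : ∀ x : ENNReal, ∏ i, ((0 : ENNReal) ^ m i * x) = 0 := fun x =>
      Finset.prod_eq_zero (Finset.mem_univ i) (by simp [hi])
    have hprod' : ∏ i, (0 : ENNReal) ^ m i = 0 :=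
      Finset.prod_eq_zero (Finset.mem_univ i) (by simp [hi])
    simp only [hz, zero_div, ENNReal.ofReal_zero, mul_zero, neg_zero, hprod, hprod',
      lintegral_zero]
  · have key : ∀ c : ℝ, ENNReal.ofReal (c ^ (((∑ i, m i : ℕ) : ℝ) - 1)) *
          ∏ i, (ENNReal.ofReal (g i) ^ m i * ENNReal.ofReal (Real.exp (-(c * g i))))
        = (∏ i, ENNReal.ofReal (g i) ^ m i) * (ENNReal.ofReal (c ^ (((∑ i, m i : ℕ) : ℝ) - 1)) *
          ENNReal.ofReal (Real.exp (-((∑ l, g l) * c)))) := by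
      intro c
      rw [Finset.prod_mul_distrib, ← ENNReal.ofReal_prod_of_nonneg fun _ _ => (Real.exp_pos _).le,
        ← Real.exp_sum, Finset.sum_neg_distrib, ← Finset.mul_sum, mul_comm c]
      ring
    have hint : ∫⁻ c in Set.Ioi (0 : ℝ), ENNReal.ofReal (c ^ (((∑ i, m i : ℕ) : ℝ) - 1)) *
        ENNReal.ofReal (Real.exp (-((∑ l, g l) * c)))
        = ENNReal.ofReal (Real.Gamma (∑ i, m i : ℕ) / (∑ l, g l) ^ ((∑ i, m i : ℕ) : ℝ)) := by
      rw [← lintegral_rpow_mul_exp_neg_mul_Ioi hn hS]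
      refine setLIntegral_congr_fun measurableSet_Ioi fun c hc => ?_
      rw [← ENNReal.ofReal_mul]
      exact Real.rpow_nonneg (le_of_lt hc) _
    have hG := Real.Gamma_pos_of_pos hn
    simp only [key]
    rw [lintegral_const_mul _ (by fun_prop), hint,
      ENNReal.ofReal_div_of_pos (by positivity), Real.rpow_natCast, ENNReal.ofReal_pow hS.le,
      mul_left_comm, ← mul_div_assoc,
      ENNReal.inv_mul_cancel (by simpa using hG) ENNReal.ofReal_ne_top]
    simp_rw [ENNReal.ofReal_div_of_pos hS, div_eq_mul_inv, mul_pow, Finset.prod_mul_distrib,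
      Finset.prod_pow_eq_pow_sum, one_mul, ENNReal.inv_pow]

theorem lintegral_pi_prod_eq {k : ℕ} (ν : Fin k → Measure ℝ) [∀ i, IsProbabilityMeasure (ν i)]
    (f : Fin k → ℝ → ENNReal) (hf : ∀ i, Measurable (f i)) :
    ∫⁻ g, ∏ i, f i (g i) ∂Measure.pi ν = ∏ i, ∫⁻ x, f i x ∂ν i := by
  have hind := iIndepFun_pi (μ := ν) (X := f) fun i => (hf i).aemeasurable
  rw [lintegral_prod_eq_prod_lintegral_of_indepFun Finset.univ _ hind
    fun i => (hf i).comp (measurable_pi_apply i)]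
  refine Finset.prod_congr rfl fun i _ => ?_
  exact (measurePreserving_eval ν i).lintegral_comp (hf i)

/-- After Tonelli, the powers of 1 + c coming from the coordinates merge into one, whose exponent
involves only the total mass and the total order. The remaining integral over c is therefore the
same for every dimension. -/
theorem lintegral_dirichletLaw_aux {k : ℕ} {a : Fin k → ℝ} (ha : ∀ i, 0 ≤ a i) (m : Fin k → ℕ)
    (hm : 0 < ∑ i, m i) :
    ∫⁻ p, ∏ i, ENNReal.ofReal (p i) ^ m i ∂dirichletLaw a
      = (∏ i, ENNReal.ofReal ((ascPochhammer ℝ (m i)).eval (a i))) *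
        dirichletNormalizer (∑ i, a i) (∑ i, m i) := by
  have := fun i => isProbabilityMeasure_gammaLaw (a i)
  have hmeas : Measurable fun (g : Fin k → ℝ) i => g i / ∑ l, g l := by fun_prop
  rw [dirichletLaw, lintegral_map (by fun_prop) hmeas]
  have hae : ∀ᵐ g ∂Measure.pi fun i => gammaLaw (a i), ∀ i, 0 ≤ g i := by
    rw [ae_all_iff]
    exact fun i => (measurePreserving_eval (fun i => gammaLaw (a i)) i).quasiMeasurePreserving.ae
      (gammaLaw_ae_nonneg (a i))
  rw [lintegral_congr_ae (hae.mono fun g hg => prod_ofReal_div_sum_pow hg m hm),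
    lintegral_const_mul' _ _ (ENNReal.inv_ne_top.2 (by
      simpa using Real.Gamma_pos_of_pos (by exact_mod_cast hm))),
    lintegral_lintegral_swap (by fun_prop), dirichletNormalizer, mul_left_comm,
    ← lintegral_const_mul' _ _ (ENNReal.prod_ne_top fun _ _ => ENNReal.ofReal_ne_top)]
  congr 1
  refine setLIntegral_congr_fun measurableSet_Ioi fun c hc => ?_
  have hc' : 0 ≤ c := le_of_lt hc
  rw [lintegral_const_mul _ (by fun_prop),
    lintegral_pi_prod_eq (fun i => gammaLaw (a i))
      (fun i x => ENNReal.ofReal x ^ m i * ENNReal.ofReal (Real.exp (-(c * x))))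
      fun i => by fun_prop]
  simp_rw [fun i => lintegral_pow_mul_exp_gammaLaw (ha i) hc' (m i),
    fun i => ENNReal.ofReal_mul (ascPochhammer_eval_nonneg (ha i) (m i)) (q := (1 + c) ^ (-(a i + m i)))]
  rw [Finset.prod_mul_distrib, ← ENNReal.ofReal_prod_of_nonneg (f := fun i => (1 + c) ^ _)
    fun _ _ => by positivity, ← Real.rpow_sum_of_pos (by positivity), Finset.sum_neg_distrib,
    Finset.sum_add_distrib, Nat.cast_sum]
  ring

/-- No beta integral is evaluated: for k = 1 the Dirichlet vector is almost surely g/g = 1, so all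
its moments are 1, which determines the normalizer. -/
theorem dirichletNormalizer_eq {A : ℝ} (hA : 0 < A) {n : ℕ} (hn : 0 < n) :
    dirichletNormalizer A n = (ENNReal.ofReal ((ascPochhammer ℝ n).eval A))⁻¹ := by
  have h := lintegral_dirichletLaw_aux (k := 1) (a := fun _ => A) (fun _ => hA.le) (fun _ => n)
    (by simpa using hn)
  have := isProbabilityMeasure_gammaLaw A
  have hmeas : Measurable fun (g : Fin 1 → ℝ) i => g i / ∑ l, g l := by fun_prop
  have h1 : ∫⁻ p, ∏ i : Fin 1, ENNReal.ofReal (p i) ^ n ∂dirichletLaw (fun _ : Fin 1 => A) = 1 := by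
    rw [dirichletLaw, lintegral_map (by fun_prop) hmeas]
    have hae : ∀ᵐ g ∂Measure.pi fun _ : Fin 1 => gammaLaw A, 0 < g 0 :=
      (measurePreserving_eval (fun _ : Fin 1 => gammaLaw A) 0).quasiMeasurePreserving.ae
        (gammaLaw_ae_pos hA)
    rw [lintegral_congr_ae (hae.mono fun g hg => ?_), lintegral_one, measure_univ]
    simp [hg.ne']
  rw [h1] at h
  simp only [Finset.univ_unique, Finset.prod_singleton, Finset.sum_singleton] at h
  exact ENNReal.eq_inv_of_mul_eq_one_left (by rw [mul_comm]; exact h.symm)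

/-- The mixed moments of a Dirichlet vector. -/
theorem lintegral_dirichletLaw {k : ℕ} {a : Fin k → ℝ} (ha : ∀ i, 0 ≤ a i) (hA : 0 < ∑ i, a i)
    (m : Fin k → ℕ) :
    ∫⁻ p, ∏ i, ENNReal.ofReal (p i) ^ m i ∂dirichletLaw a
      = (∏ i, ENNReal.ofReal ((ascPochhammer ℝ (m i)).eval (a i))) *
        (ENNReal.ofReal ((ascPochhammer ℝ (∑ i, m i)).eval (∑ i, a i)))⁻¹ := by
  rcases Nat.eq_zero_or_pos (∑ i, m i) with h | h
  · have hz : ∀ i, m i = 0 := by simpa using h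
    have := fun i => isProbabilityMeasure_gammaLaw (a i)
    have hmeas : Measurable fun (g : Fin k → ℝ) i => g i / ∑ l, g l := by fun_prop
    have : IsProbabilityMeasure (dirichletLaw a) :=
      Measure.isProbabilityMeasure_map hmeas.aemeasurable
    simp [hz]
  · rw [lintegral_dirichletLaw_aux ha m h, dirichletNormalizer_eq hA h]

/-- The moment recursion behind the Blackwell–MacQueen urn. -/
theorem lintegral_dirichletLaw_mul {k : ℕ} {a : Fin k → ℝ} (ha : ∀ i, 0 ≤ a i)
    (hA : 0 < ∑ i, a i) {ι : Type*} (S : Finset ι) (f : ι → Fin k) (i : Fin k) :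
    (ENNReal.ofReal (∑ i, a i) + S.card) *
        ∫⁻ p, (∏ x ∈ S, ENNReal.ofReal (p (f x))) * ENNReal.ofReal (p i) ∂dirichletLaw a
      = (ENNReal.ofReal (a i) + (S.filter fun x => f x = i).card) *
        ∫⁻ p, ∏ x ∈ S, ENNReal.ofReal (p (f x)) ∂dirichletLaw a := by
  set m : Fin k → ℕ := fun l => (S.filter fun x => f x = l).card with hm
  have hprod : ∀ p : Fin k → ℝ,
      ∏ x ∈ S, ENNReal.ofReal (p (f x)) = ∏ l, ENNReal.ofReal (p l) ^ m l := fun p => by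
    rw [← Finset.prod_fiberwise S f]
    refine Finset.prod_congr rfl fun l _ => ?_
    rw [Finset.prod_congr rfl (g := fun _ => ENNReal.ofReal (p l)), Finset.prod_const]
    intro x hx
    rw [(Finset.mem_filter.1 hx).2]
  have hcard : ∑ l, m l = S.card :=
    (Finset.card_eq_sum_card_fiberwise (s := S) (t := Finset.univ) fun _ _ => by simp).symm
  -- The extra factor `p i` raises one exponent by 1, and the two moments differ by the last factors
  -- of the ascending factorials, a_i + m_i and ∑ a + |S|.
  set m' : Fin k → ℕ := Function.update m i (m i + 1) with hm'
  have hupd : ∀ (F : Fin k → ℕ → ENNReal),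
      ∏ l, F l (m' l) = (∏ l ∈ Finset.univ.erase i, F l (m l)) * F i (m i + 1) := fun F => by
    rw [← Finset.prod_erase_mul _ _ (Finset.mem_univ i), hm', Function.update_self]
    congr 1
    refine Finset.prod_congr rfl fun l hl => ?_
    rw [Function.update_of_ne (Finset.ne_of_mem_erase hl)]
  have hprod' : ∀ p : Fin k → ℝ, (∏ x ∈ S, ENNReal.ofReal (p (f x))) * ENNReal.ofReal (p i)
      = ∏ l, ENNReal.ofReal (p l) ^ m' l := fun p => by
    rw [hprod, hupd fun l e => ENNReal.ofReal (p l) ^ e, pow_succ, ← mul_assoc,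
      Finset.prod_erase_mul _ _ (Finset.mem_univ i)]
  have hcard' : ∑ l, m' l = S.card + 1 := by
    rw [← hcard, ← Finset.sum_erase_add _ _ (Finset.mem_univ i),
      ← Finset.sum_erase_add (Finset.univ) m (Finset.mem_univ i), hm', Function.update_self,
      ← add_assoc]
    congr 2
    refine Finset.sum_congr rfl fun l hl => ?_
    rw [Function.update_of_ne (Finset.ne_of_mem_erase hl)]
  simp_rw [hprod', hprod]
  rw [lintegral_dirichletLaw ha hA, lintegral_dirichletLaw ha hA, hcard, hcard',
    hupd fun l e => ENNReal.ofReal ((ascPochhammer ℝ e).eval (a l)),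
    ← Finset.prod_erase_mul _ _ (Finset.mem_univ i), ascPochhammer_succ_eval,
    ascPochhammer_succ_eval, ENNReal.ofReal_mul (ascPochhammer_eval_nonneg (ha i) _),
    ENNReal.ofReal_mul (ascPochhammer_eval_nonneg hA.le _),
    ENNReal.ofReal_add (ha i) (Nat.cast_nonneg _), ENNReal.ofReal_add hA.le (Nat.cast_nonneg _),
    ENNReal.ofReal_natCast, ENNReal.ofReal_natCast]
  have h0 : ENNReal.ofReal (∑ i, a i) + S.card ≠ 0 := by simp [hA]
  have h1 : ENNReal.ofReal (∑ i, a i) + S.card ≠ ⊤ := by simp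
  rw [ENNReal.mul_inv (Or.inr h1) (Or.inr h0)]
  have key : ∀ c E F w Z : ENNReal, c ≠ 0 → c ≠ ⊤ →
      c * (E * (F * w) * (Z * c⁻¹)) = w * (E * F * Z) := fun c E F w Z hc hc' => by
    calc _ = c * c⁻¹ * (w * (E * F * Z)) := by ring
      _ = _ := by rw [ENNReal.mul_inv_cancel hc hc', one_mul]
  exact key _ _ _ _ _ h0 h1

/-! ### From Dirichlet processes to the urn. -/

section UrnScheme

variable {Ω α ι : Type*} [MeasurableSpace Ω] [MeasurableSpace α] {μ : Measure Ω}

theorem IsCondIID.measure_forall_mem {P : Kernel Ω α} {y : ι → Ω → α} (h : IsCondIID μ P y)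
    (S : Finset ι) {B : ι → Set α} (hB : ∀ i, MeasurableSet (B i)) :
    μ {ω | ∀ i ∈ S, y i ω ∈ B i} = ∫⁻ ω, ∏ i ∈ S, P ω (B i) ∂μ := by
  simpa using h S B hB Set.univ MeasurableSet.univ

/-- The fibres of φ form a finite measurable partition, so their random masses are a Dirichlet
vector of total parameter θ and the moment recursion applies. -/
theorem IsDirichletProcess.lintegral_prod_mul {K : Type*} [Fintype K] [MeasurableSpace K]
    [MeasurableSingletonClass K] {θ : ℝ} (hθ : 0 < θ) {G : Measure α} [IsProbabilityMeasure G]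
    {P : Kernel Ω α} [IsMarkovKernel P] (h : IsDirichletProcess μ θ G P) {φ : α → K}
    (hφ : Measurable φ) (S : Finset ι) (f : ι → K) (σ : K) [DecidableEq K] :
    (ENNReal.ofReal θ + S.card) *
        ∫⁻ ω, (∏ a ∈ S, P ω (φ ⁻¹' {f a})) * P ω (φ ⁻¹' {σ}) ∂μ
      = (ENNReal.ofReal θ * G (φ ⁻¹' {σ}) + (S.filter fun a => f a = σ).card) *
        ∫⁻ ω, ∏ a ∈ S, P ω (φ ⁻¹' {f a}) ∂μ := by
  set e := Fintype.equivFin K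
  set A : Fin (Fintype.card K) → Set α := fun i => φ ⁻¹' {e.symm i} with hA
  have hAm : ∀ i, MeasurableSet (A i) := fun i => hφ (measurableSet_singleton _)
  have hdisj : Pairwise fun i l => Disjoint (A i) (A l) := fun i l hil =>
    Disjoint.preimage _ (by simpa using hil)
  have hU : ⋃ i, A i = Set.univ := by
    ext x
    simp only [hA, Set.mem_iUnion, Set.mem_preimage, Set.mem_singleton_iff, Set.mem_univ, iff_true]
    exact ⟨e (φ x), by simp⟩
  have hlaw := h _ A hAm hdisj hU
  have hsum : ∑ i, θ * G.real (A i) = θ := by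
    rw [← Finset.mul_sum, ← measureReal_iUnion_fintype hdisj hAm, hU]
    simp
  have hmeas : Measurable fun ω i => (P ω).real (A i) :=
    measurable_pi_lambda _ fun i => (P.measurable_coe (hAm i)).ennreal_toReal
  have hval : ∀ (ω : Ω) (τ : K), P ω (φ ⁻¹' {τ}) = ENNReal.ofReal ((P ω).real (A (e τ))) := by
    intro ω τ
    rw [ofReal_measureReal, hA]
    simp
  have key := lintegral_dirichletLaw_mul (a := fun i => θ * G.real (A i))
    (fun i => by positivity) (by rw [hsum]; exact hθ) S (fun a => e (f a)) (e σ)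
  rw [← hlaw, hsum, lintegral_map (by fun_prop) hmeas, lintegral_map (by fun_prop) hmeas] at key
  simp only [hval]
  rw [key, ENNReal.ofReal_mul hθ.le]
  simp [hA]

theorem measure_inter_preimage_finset_eq_sum {K L : Type*} [MeasurableSpace K] [MeasurableSpace L]
    [MeasurableSingletonClass K] [MeasurableSingletonClass L] {g : Ω → K} {g' : Ω → L}
    (hg : Measurable g) (hg' : Measurable g') (F : Finset K) (D : Finset L) :
    μ {ω | g ω ∈ F ∧ g' ω ∈ D} = ∑ f ∈ F, ∑ σ ∈ D, μ {ω | g ω = f ∧ g' ω = σ} := by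
  rw [← Finset.sum_product']
  have := sum_measure_preimage_singleton (μ := μ) (F ×ˢ D) (f := fun ω => (g ω, g' ω))
    fun y _ => hg.prodMk hg' (measurableSet_singleton y)
  simpa [Set.preimage, Prod.ext_iff] using this.symm

theorem measure_preimage_finset_eq_sum {K : Type*} [MeasurableSpace K]
    [MeasurableSingletonClass K] {g : Ω → K} (hg : Measurable g) (F : Finset K) :
    μ {ω | g ω ∈ F} = ∑ f ∈ F, μ {ω | g ω = f} :=
  (sum_measure_preimage_singleton (μ := μ) F (f := g)
    fun y _ => hg (measurableSet_singleton y)).symm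

open Classical in
/-- One step of the Blackwell–MacQueen urn for a sample from a Dirichlet process, on rectangles. -/
theorem IsDPSample.measure_forall_mem_and_mem {θ : ℝ} (hθ : 0 < θ) {G : Measure α}
    [IsProbabilityMeasure G] {P : Kernel Ω α} [IsMarkovKernel P] {y : ι → Ω → α}
    (h : IsDPSample μ θ G P y) {S : Finset ι} {v : ι} (hv : v ∉ S) {B : ι → Set α}
    (hB : ∀ i, MeasurableSet (B i)) {C : Set α} (hC : MeasurableSet C) :
    (ENNReal.ofReal θ + S.card) * μ {ω | (∀ a ∈ S, y a ω ∈ B a) ∧ y v ω ∈ C}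
      = ENNReal.ofReal θ * G C * μ {ω | ∀ a ∈ S, y a ω ∈ B a} +
        ∑ a ∈ S, μ {ω | (∀ b ∈ S, y b ω ∈ B b) ∧ y a ω ∈ C} := by
  -- A point is coded by the truth values of its membership in C and in each B a. All these sets are
  -- then unions of the finitely many cells of φ, and the claim is a sum over cells.
  let K := Option S → Bool
  let E : Option S → Set α := fun o => o.elim C fun a => B a
  have hE : ∀ o, MeasurableSet (E o) := by
    rintro (_ | a)
    exacts [hC, hB a]
  let φ : α → K := fun x o => decide (x ∈ E o)
  have hφE : ∀ x o, φ x o = true ↔ x ∈ E o := fun x o => by simp [φ]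
  have hφ : Measurable φ := measurable_pi_lambda _ fun o => measurable_to_bool (by
    rw [show (fun x => φ x o) ⁻¹' {true} = E o by ext x; exact hφE x o]
    exact hE o)
  let g : Ω → S → K := fun ω a => φ (y a ω)
  have hg : Measurable g := measurable_pi_lambda _ fun a => hφ.comp (h.measurable a)
  have hgv : Measurable fun ω => φ (y v ω) := hφ.comp (h.measurable v)
  let F : Finset (S → K) := Finset.univ.filter fun f => ∀ a, f a (some a) = true
  let D : Finset K := Finset.univ.filter fun σ => σ none = true
  have hF : ∀ ω, g ω ∈ F ↔ ∀ a ∈ S, y a ω ∈ B a := fun ω => by simp [F, g, hφE, E]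
  have hD : ∀ x, φ x ∈ D ↔ x ∈ C := fun x => by simp [D, hφE, E]
  have hcell : ∀ f : S → K, μ {ω | g ω = f}
      = ∫⁻ ω, ∏ a : S, P ω (φ ⁻¹' {f a}) ∂μ := by
    intro f
    have h1 := h.isCondIID.measure_forall_mem S
      (B := fun a => φ ⁻¹' {if ha : a ∈ S then f ⟨a, ha⟩ else fun _ => true})
      fun a => hφ (measurableSet_singleton _)
    have h2 : {ω | g ω = f} = {ω | ∀ a ∈ S, y a ω ∈
        φ ⁻¹' {if ha : a ∈ S then f ⟨a, ha⟩ else fun _ => true}} := by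
      ext ω
      simp only [Set.mem_ofPred_eq, funext_iff (f := g ω), Subtype.forall, g]
      refine forall_congr' fun a => forall_congr' fun ha => ?_
      simp [ha]
    rw [h2, h1]
    refine lintegral_congr fun ω => ?_
    rw [← Finset.prod_coe_sort]
    exact Finset.prod_congr rfl fun a _ => by simp
  have hcell' : ∀ (f : S → K) (σ : K), μ {ω | g ω = f ∧ φ (y v ω) = σ}
      = ∫⁻ ω, (∏ a : S, P ω (φ ⁻¹' {f a})) * P ω (φ ⁻¹' {σ}) ∂μ := by
    intro f σ
    have h1 := h.isCondIID.measure_forall_mem (insert v S)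
      (B := fun a => φ ⁻¹' {if ha : a ∈ S then f ⟨a, ha⟩ else σ})
      fun a => hφ (measurableSet_singleton _)
    have h2 : {ω | g ω = f ∧ φ (y v ω) = σ} = {ω | ∀ a ∈ insert v S, y a ω ∈
        φ ⁻¹' {if ha : a ∈ S then f ⟨a, ha⟩ else σ}} := by
      ext ω
      simp only [Set.mem_ofPred_eq, funext_iff (f := g ω), Subtype.forall, g, Finset.forall_mem_insert]
      rw [and_comm]
      refine and_congr (by simp [hv]) (forall_congr' fun a => forall_congr' fun ha => ?_)
      simp [ha]
    rw [h2, h1]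
    refine lintegral_congr fun ω => ?_
    rw [Finset.prod_insert hv, mul_comm, ← Finset.prod_coe_sort]
    simp [hv]
  have hrec : ∀ (f : S → K) (σ : K), (ENNReal.ofReal θ + S.card) *
      μ {ω | g ω = f ∧ φ (y v ω) = σ}
      = (ENNReal.ofReal θ * G (φ ⁻¹' {σ}) + (Finset.univ.filter fun a => f a = σ).card) *
        μ {ω | g ω = f} := by
    intro f σ
    rw [hcell, hcell', ← IsDirichletProcess.lintegral_prod_mul hθ h.2 hφ Finset.univ f σ]
    simp
  have hL : {ω | (∀ a ∈ S, y a ω ∈ B a) ∧ y v ω ∈ C} = {ω | g ω ∈ F ∧ φ (y v ω) ∈ D} := by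
    ext ω
    simp only [Set.mem_ofPred_eq, hF, hD]
  have hR : {ω | ∀ a ∈ S, y a ω ∈ B a} = {ω | g ω ∈ F} := by
    ext ω
    simp only [Set.mem_ofPred_eq, hF]
  have hRa : ∀ a : S, {ω | (∀ b ∈ S, y b ω ∈ B b) ∧ y a ω ∈ C}
      = {ω | g ω ∈ F.filter fun f => f a ∈ D} := by
    intro a
    ext ω
    simp only [Set.mem_ofPred_eq, Finset.mem_filter, hF, hD, g]
  have hGC : G C = ∑ σ ∈ D, G (φ ⁻¹' {σ}) := by
    rw [sum_measure_preimage_singleton D fun σ _ => hφ (measurableSet_singleton σ)]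
    congr 1
    ext x
    simp [hD]
  rw [hL, hR, measure_inter_preimage_finset_eq_sum hg hgv, measure_preimage_finset_eq_sum hg, hGC,
    ← Finset.sum_coe_sort S]
  simp_rw [hRa, measure_preimage_finset_eq_sum hg, Finset.mul_sum, hrec, Finset.sum_filter (s := F)]
  rw [Finset.sum_comm (s := Finset.univ), ← Finset.sum_add_distrib]
  refine Finset.sum_congr rfl fun f _ => ?_
  simp_rw [add_mul, Finset.sum_add_distrib, ← Finset.sum_mul]
  congr 1
  -- For a fixed cell assignment f, both sides count the sampled points whose cell lies in C, the
  -- right side cell by cell.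
  rw [← Finset.sum_filter, Finset.sum_const, nsmul_eq_mul, ← Nat.cast_sum]
  congr 2
  rw [Finset.card_eq_sum_card_fiberwise (s := Finset.univ.filter fun a => f a ∈ D) (t := D) (f := f)
    fun a ha => by simpa using ha]
  refine Finset.sum_congr rfl fun σ hσ => ?_
  congr 1
  ext a
  simp only [Finset.mem_filter, Finset.mem_univ, true_and]
  exact ⟨fun h => ⟨h ▸ hσ, h⟩, fun h => h.2⟩

end UrnScheme

/-! ### Layered urns and their integration rule. -/

section UrnSample

variable {Ω α ι J : Type*} [DecidableEq J] [MeasurableSpace Ω] [MeasurableSpace α] {μ : Measure Ω}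

/-- The variables `y` follow, separately in each layer, the Blackwell–MacQueen urn scheme with
concentration parameter `θ` and base probability measures `G`. -/
structure IsUrnSample (μ : Measure Ω) (θ : ENNReal) (lay : ι → J) (G : J → Measure α)
    (y : ι → Ω → α) : Prop where
  measurable : ∀ i, Measurable (y i)
  measure_rect : ∀ (S : Finset ι) (v : ι), v ∉ S → ∀ B : ι → Set α, (∀ i, MeasurableSet (B i)) →
    ∀ C : Set α, MeasurableSet C →
      (θ + (S.filter fun a => lay a = lay v).card) *
          μ {ω | (∀ a ∈ S, y a ω ∈ B a) ∧ y v ω ∈ C}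
        = θ * G (lay v) C * μ {ω | ∀ a ∈ S, y a ω ∈ B a} +
          ∑ a ∈ S.filter (fun a => lay a = lay v), μ {ω | (∀ b ∈ S, y b ω ∈ B b) ∧ y a ω ∈ C}

theorem IsDPSample.isUrnSample {θ : ℝ} (hθ : 0 < θ) {G : Measure α}
    [IsProbabilityMeasure G] {P : Kernel Ω α} [IsMarkovKernel P] {y : ι → Ω → α}
    (h : IsDPSample μ θ G P y) :
    IsUrnSample μ (ENNReal.ofReal θ) (fun _ => ()) (fun _ => G) y where
  measurable := h.measurable
  measure_rect S v hv B hB C hC := by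
    simpa using h.measure_forall_mem_and_mem hθ hv hB hC

/-- By independence, the constraints on nodes outside the layer of v contribute one common factor c
to every term, and what is left is the urn identity of that layer. -/
theorem isUrnSample_of_layers {N d : ℕ} {lay : Fin N → Fin d} {θ : ENNReal} {G : Fin d → Measure α}
    {t : Fin N → Ω → α}
    (h : ∀ j, IsUrnSample μ θ (fun _ => ()) (fun _ => G j) fun v : {v // lay v = j} => t v)
    (hind : iIndepFun (fun j ω => fun v : {v // lay v = j} => t v ω) μ) :
    IsUrnSample μ θ lay G t where
  measurable i := (h (lay i)).measurable ⟨i, rfl⟩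
  measure_rect S v hv B hB C hC := by
    classical
    set j := lay v with hj
    let R : ∀ j', Set ({v // lay v = j'} → α) := fun j' => {τ | ∀ a : {v // lay v = j'}, a.1 ∈ S → τ a ∈ B a}
    have hR : ∀ j', MeasurableSet (R j') := fun j' => by
      simp only [R, Set.ofPred_forall]
      exact MeasurableSet.iInter fun a => MeasurableSet.iInter fun _ => measurable_pi_apply a (hB a)
    obtain ⟨c, hc⟩ : ∃ c : ENNReal, ∀ D : Set ({v // lay v = j} → α), MeasurableSet D →
        μ {ω | (∀ a ∈ S, lay a ≠ j → t a ω ∈ B a) ∧ (fun a : {v // lay v = j} => t a ω) ∈ D}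
          = c * μ {ω | (fun a : {v // lay v = j} => t a ω) ∈ D} := by
      refine ⟨∏ i ∈ Finset.univ.erase j, μ ((fun ω (a : {v // lay v = i}) => t a ω) ⁻¹' R i),
        fun D hD => ?_⟩
      have h1 := hind.measure_inter_preimage_eq_mul Finset.univ
        (sets := fun j' => if hj' : j' = j then hj' ▸ D else R j') (by
          intro j' _
          by_cases hj' : j' = j
          · subst hj'
            simpa using hD
          · simpa [hj'] using hR j')
      rw [← Finset.prod_erase_mul _ _ (Finset.mem_univ j)] at h1
      have h2 : {ω | (∀ a ∈ S, lay a ≠ j → t a ω ∈ B a) ∧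
          (fun a : {v // lay v = j} => t a ω) ∈ D}
          = ⋂ i ∈ Finset.univ, (fun ω (a : {v // lay v = i}) => t a ω) ⁻¹'
            (if hj' : i = j then hj' ▸ D else R i) := by
        ext ω
        simp only [Finset.mem_univ, Set.iInter_true, Set.mem_iInter, Set.mem_preimage,
          Set.mem_ofPred_eq]
        constructor
        · rintro ⟨h1, h2⟩ i
          by_cases hi : i = j
          · subst hi
            simpa using h2
          · simp only [hi, dite_false, R, Set.mem_ofPred_eq]
            intro a ha
            exact h1 a ha (by rw [a.2]; exact hi)
        · intro hall
          refine ⟨fun a ha haj => ?_, by simpa using hall j⟩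
          have := hall (lay a)
          simp only [haj, dite_false, R, Set.mem_ofPred_eq] at this
          exact this ⟨a, rfl⟩ ha
      rw [h2, h1]
      congr 1
      · refine Finset.prod_congr rfl fun i hi => ?_
        simp [Finset.ne_of_mem_erase hi]
      · simp [Set.preimage]
    let S₀ : Finset {v // lay v = j} := S.subtype fun a => lay a = j
    have hS₀ : ∀ a : {v // lay v = j}, a ∈ S₀ ↔ a.1 ∈ S := fun a => by simp [S₀]
    have key := (h j).measure_rect S₀ ⟨v, rfl⟩ (by simpa [hS₀] using hv) (fun a => B a)
      (fun a => hB a) C hC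
    simp only [Finset.filter_true] at key
    have hcard : S₀.card = (S.filter fun a => lay a = j).card := Finset.card_subtype _ _
    have hrest : ∀ ω, (∀ a ∈ S, t a ω ∈ B a) ↔ (∀ a ∈ S, lay a ≠ j → t a ω ∈ B a) ∧
        ∀ a ∈ S₀, t a ω ∈ B a := by
      intro ω
      constructor
      · exact fun hall => ⟨fun a ha _ => hall a ha, fun a ha => hall a ((hS₀ a).1 ha)⟩
      · intro hall a ha
        by_cases haj : lay a = j
        · exact hall.2 ⟨a, haj⟩ ((hS₀ _).2 ha)
        · exact hall.1 a ha haj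
    have hrect : MeasurableSet {τ : {v // lay v = j} → α | ∀ a ∈ S₀, τ a ∈ B a} := by
      simpa only [hS₀] using hR j
    have e1 : μ {ω | ∀ a ∈ S, t a ω ∈ B a} = c * μ {ω | ∀ a ∈ S₀, t a ω ∈ B a} := by
      simp_rw [hrest]
      exact hc _ hrect
    have e2 : ∀ a : {v // lay v = j}, μ {ω | (∀ a ∈ S, t a ω ∈ B a) ∧ t a ω ∈ C}
        = c * μ {ω | (∀ a ∈ S₀, t a ω ∈ B a) ∧ t a ω ∈ C} := by
      intro a
      simp_rw [hrest, and_assoc]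
      exact hc _ (hrect.inter (measurable_pi_apply a hC))
    rw [← hcard, e1, e2 ⟨v, rfl⟩, mul_left_comm, mul_left_comm (θ * G j C), key, mul_add,
      Finset.mul_sum, ← Finset.sum_subtype_eq_sum_filter
        (f := fun a => μ {ω | (∀ b ∈ S, t b ω ∈ B b) ∧ t a ω ∈ C})]
    simp_rw [e2]
    rfl

/-- The scaled joint law of past and new draw (M₁) and the urn mixture (M₂) agree on rectangles, a
π-system generating the product σ-algebra. They are finite measures, hence equal, and F can be
integrated against both. -/
theorem IsUrnSample.lintegral_domRestrict [IsFiniteMeasure μ] {θ : ENNReal} (hθ : θ ≠ ⊤)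
    {lay : ι → J}
    {G : J → Measure α} [∀ j, IsFiniteMeasure (G j)] {y : ι → Ω → α} (h : IsUrnSample μ θ lay G y)
    {S : Finset ι} {v : ι} (hv : v ∉ S) {F : (S → α) × α → ENNReal} (hF : Measurable F) :
    (θ + (S.filter fun a => lay a = lay v).card) * ∫⁻ ω, F (fun a => y a ω, y v ω) ∂μ
      = θ * ∫⁻ ω, ∫⁻ x, F (fun a => y a ω, x) ∂G (lay v) ∂μ +
        ∑ a ∈ S.filter (fun a => lay a = lay v), ∫⁻ ω, F (fun b => y b ω, y a ω) ∂μ := by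
  classical
  have hm := h.measurable
  have hyS : Measurable fun ω (a : S) => y a ω := measurable_pi_lambda _ fun a => hm a
  set M₁ : Measure ((S → α) × α) := (θ + (S.filter fun a => lay a = lay v).card) •
    μ.map fun ω => (fun a : S => y a ω, y v ω)
  set M₂ : Measure ((S → α) × α) := θ • (μ.map fun ω (a : S) => y a ω).prod (G (lay v)) +
    ∑ a ∈ S.filter (fun a => lay a = lay v), μ.map fun ω => (fun b : S => y b ω, y a ω)
  have hrect : ∀ (B : S → Set α) (C : Set α), (∀ a, MeasurableSet (B a)) → MeasurableSet C →
      M₁ (Set.univ.pi B ×ˢ C) = M₂ (Set.univ.pi B ×ˢ C) := by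
    intro B C hB hC
    have key := h.measure_rect S v hv (fun a => if ha : a ∈ S then B ⟨a, ha⟩ else Set.univ)
      (fun a => by split_ifs; exacts [hB _, MeasurableSet.univ]) C hC
    have hpi : MeasurableSet (Set.univ.pi B) := MeasurableSet.univ_pi hB
    have hev : ∀ ω, (∀ a ∈ S, y a ω ∈ (if ha : a ∈ S then B ⟨a, ha⟩ else Set.univ)) ↔
        (fun a : S => y a ω) ∈ Set.univ.pi B := by
      intro ω
      simp only [Set.mem_pi, Set.mem_univ, true_imp_iff, Subtype.forall]
      exact forall_congr' fun a => forall_congr' fun ha => by simp [ha]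
    simp_rw [hev] at key
    simp only [M₁, M₂, Measure.smul_apply, Measure.add_apply, Measure.finsetSum_apply, smul_eq_mul]
    rw [Measure.prod_prod, Measure.map_apply hyS hpi,
      Measure.map_apply (hyS.prodMk (hm v)) (hpi.prod hC)]
    rw [Finset.sum_congr rfl fun a _ => Measure.map_apply (hyS.prodMk (hm a)) (hpi.prod hC),
      mul_comm (μ _) (G (lay v) C), ← mul_assoc]
    exact key
  have hM₁ : IsFiniteMeasure M₁ := ⟨by
    simp only [M₁, Measure.smul_apply, smul_eq_mul]
    exact ENNReal.mul_lt_top (by simp [hθ.lt_top]) (measure_lt_top _ _)⟩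
  have hM : M₁ = M₂ := by
    refine ext_of_generate_finite _ (generateFrom_eq_prod generateFrom_pi
      MeasurableSpace.generateFrom_measurableSet ?_ isCountablySpanning_measurableSet).symm
      (isPiSystem_pi.prod MeasurableSpace.isPiSystem_measurableSet) ?_ ?_
    · exact IsCountablySpanning.pi fun _ => isCountablySpanning_measurableSet
    · rintro _ ⟨_, ⟨B, hB, rfl⟩, C, hC, rfl⟩
      exact hrect B C (fun a => hB a (Set.mem_univ a)) hC
    · have := hrect (fun _ => Set.univ) Set.univ (fun _ => MeasurableSet.univ) MeasurableSet.univ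
      simpa using this
  have key := congrArg (fun M => ∫⁻ p, F p ∂M) hM
  simp only [M₁, M₂, lintegral_add_measure, lintegral_smul_measure, smul_eq_mul,
    lintegral_finsetSum_measure] at key
  rw [lintegral_map hF (hyS.prodMk (hm v)), lintegral_prod _ hF.aemeasurable,
    lintegral_map hF.lintegral_prod_right' hyS,
    Finset.sum_congr rfl fun a _ => lintegral_map hF (hyS.prodMk (hm a))] at key
  exact key

/-- One step of the urn scheme, for functionals that depend on the past through `S` only. -/
theorem IsUrnSample.lintegral [IsFiniteMeasure μ] {θ : ENNReal} (hθ : θ ≠ ⊤) {lay : ι → J}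
    {G : J → Measure α} [∀ j, IsFiniteMeasure (G j)] {y : ι → Ω → α} (h : IsUrnSample μ θ lay G y)
    {S : Finset ι} {v : ι} (hv : v ∉ S) {F : (ι → α) → α → ENNReal}
    (hF : Measurable fun p : (ι → α) × α => F p.1 p.2) (hdep : ∀ x, DependsOn (F · x) S) :
    (θ + (S.filter fun a => lay a = lay v).card) * ∫⁻ ω, F (fun a => y a ω) (y v ω) ∂μ
      = θ * ∫⁻ ω, ∫⁻ x, F (fun a => y a ω) x ∂G (lay v) ∂μ +
        ∑ a ∈ S.filter (fun a => lay a = lay v), ∫⁻ ω, F (fun b => y b ω) (y a ω) ∂μ := by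
  rcases isEmpty_or_nonempty Ω with hΩ | ⟨⟨ω₀⟩⟩
  · simp [μ.eq_zero_of_isEmpty]
  classical
  -- The coordinates off S are filled with the values at an arbitrary ω₀; F does not see them.
  let E : (S → α) → ι → α := fun r a => if ha : a ∈ S then r ⟨a, ha⟩ else y a ω₀
  have hE : Measurable E := measurable_pi_lambda _ fun a => by
    by_cases ha : a ∈ S
    · simpa [E, ha] using measurable_pi_apply _
    · simp [E, ha]
  have hFE : ∀ ω x, F (E fun a => y a ω) x = F (fun a => y a ω) x := fun ω x =>
    hdep x fun a ha => by simp [E, Finset.mem_coe.1 ha]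
  have key := h.lintegral_domRestrict hθ hv (F := fun p => F (E p.1) p.2)
    (hF.comp ((hE.comp measurable_fst).prodMk measurable_snd))
  simpa only [hFE] using key

end UrnSample

/-! ### Exchangeability of conditionally iid samples. -/

section Exchangeability

variable {Ω α ι κ : Type*} [MeasurableSpace Ω] [MeasurableSpace α] {μ : Measure Ω}

theorem IsCondIID.comp_injective {P : Kernel Ω α} {y : ι → Ω → α} (h : IsCondIID μ P y)
    {e : κ → ι} (he : Function.Injective e) : IsCondIID μ P fun k => y (e k) := by
  intro S B hB C hC
  rcases isEmpty_or_nonempty κ with hκ | hκ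
  · have hS : S = ∅ := Finset.eq_empty_of_isEmpty S
    subst hS
    simp
  have := h (S.map ⟨e, he⟩) (fun i => B (Function.invFun e i)) (fun i => hB _) C hC
  simpa [Function.leftInverse_invFun he _] using this

/-- The probability of a rectangle is the mean of ∏ P(B k), which depends on P and the sets only,
not on the sample. -/
theorem IsCondIID.map_eq [Finite κ] [IsFiniteMeasure μ] {P : Kernel Ω α} {y y' : κ → Ω → α}
    (hy : ∀ k, Measurable (y k)) (hy' : ∀ k, Measurable (y' k))
    (h : IsCondIID μ P y) (h' : IsCondIID μ P y') :
    μ.map (fun ω k => y k ω) = μ.map fun ω k => y' k ω := by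
  have := Fintype.ofFinite κ
  have hrect : ∀ B : κ → Set α, (∀ k, MeasurableSet (B k)) →
      μ.map (fun ω k => y k ω) (Set.univ.pi B) = μ.map (fun ω k => y' k ω) (Set.univ.pi B) := by
    intro B hB
    rw [Measure.map_apply (measurable_pi_lambda _ hy) (MeasurableSet.univ_pi hB),
      Measure.map_apply (measurable_pi_lambda _ hy') (MeasurableSet.univ_pi hB)]
    have h1 := h.measure_forall_mem Finset.univ hB
    rw [← h'.measure_forall_mem Finset.univ hB] at h1
    simpa [Set.preimage] using h1
  refine ext_of_generate_finite _ generateFrom_pi.symm isPiSystem_pi ?_ ?_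
  · rintro _ ⟨B, hB, rfl⟩
    exact hrect B fun k => hB k (Set.mem_univ k)
  · simpa using hrect (fun _ => Set.univ) fun _ => MeasurableSet.univ

end Exchangeability

/-! ### Numbering in order of appearance. -/

section Labels

variable {ι β γ : Type*} [LinearOrder ι]

theorem appearanceLabel_congr {S : Finset ι} {f : ι → β} {g : ι → γ} {a : ι} (ha : a ∈ S)
    (h : ∀ b ∈ S, ∀ c ∈ S, f b = f c ↔ g b = g c) :
    appearanceLabel S f a = appearanceLabel S g a := by
  classical
  unfold appearanceLabel
  congr 1
  refine Finset.filter_congr fun b hb => and_congr ?_ ?_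
  · exact forall_congr' fun c => forall_congr' fun hc => imp_congr Iff.rfl (not_congr (h c hc b hb))
  · exact forall_congr' fun c => forall_congr' fun hc => imp_congr (h c hc a ha) Iff.rfl

/-- The first appearances counted for a are at most m, hence before n, so they are all counted for
b; n itself is counted for b but not for a. -/
theorem appearanceLabel_lt {S : Finset ι} {f : ι → β} {a b m n : ι}
    (hn : n ∈ S) (hnb : f n = f b)
    (hn' : ∀ c ∈ S, f c = f b → n ≤ c) (hmS : m ∈ S) (hma : f m = f a) (hmn : m < n) :
    appearanceLabel S f a < appearanceLabel S f b := by
  classical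
  unfold appearanceLabel
  refine Finset.card_lt_card ⟨fun c hc => ?_, fun hsub => ?_⟩
  · simp only [Finset.mem_filter] at hc ⊢
    exact ⟨hc.1, hc.2.1, fun e he hf => (hc.2.2 m hmS hma).trans (hmn.le.trans (hn' e he hf))⟩
  · have hmem : n ∈ S.filter fun x => (∀ c ∈ S, c < x → f c ≠ f x) ∧ ∀ c ∈ S, f c = f b → x ≤ c := by
      simp only [Finset.mem_filter]
      exact ⟨hn, fun c hc hlt heq => absurd (hn' c hc (heq.trans hnb)) (not_le.2 hlt), hn'⟩
    have := (Finset.mem_filter.1 (hsub hmem)).2.2 m hmS hma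
    exact absurd this (not_le.2 hmn)

theorem exists_first_appearance {S : Finset ι} (f : ι → β) {a : ι} (ha : a ∈ S) :
    ∃ m ∈ S, f m = f a ∧ ∀ c ∈ S, f c = f a → m ≤ c := by
  classical
  have hne : (S.filter fun c => f c = f a).Nonempty := ⟨a, by simp [ha]⟩
  have hmem := Finset.mem_filter.1 (Finset.min'_mem _ hne)
  exact ⟨_, hmem.1, hmem.2, fun c hc hf => Finset.min'_le _ _ (by simp [hc, hf])⟩

theorem appearanceLabel_eq_iff {S : Finset ι} {f : ι → β} {a b : ι} (ha : a ∈ S) (hb : b ∈ S) :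
    appearanceLabel S f a = appearanceLabel S f b ↔ f a = f b := by
  constructor
  · intro h
    by_contra hne
    obtain ⟨m, hmS, hma, hm⟩ := exists_first_appearance f ha
    obtain ⟨n, hnS, hnb, hn⟩ := exists_first_appearance f hb
    rcases lt_trichotomy m n with hlt | heq | hlt
    · exact (appearanceLabel_lt hnS hnb hn hmS hma hlt).ne h
    · exact hne (hma.symm.trans ((congrArg f heq).trans hnb))
    · exact (appearanceLabel_lt hmS hma hm hnS hnb hlt).ne' h
  · intro h
    unfold appearanceLabel
    rw [h]

/-- The elements counted by a label are first appearances of distinct values, so they carry distinct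
labels and cannot outnumber the labels in use. -/
theorem appearanceLabel_mem_Icc {S : Finset ι} (f : ι → β) {a : ι} (ha : a ∈ S) :
    appearanceLabel S f a ∈ Finset.Icc 1 (S.image (appearanceLabel S f)).card := by
  classical
  rw [Finset.mem_Icc]
  constructor
  · obtain ⟨m, hmS, hma, hm⟩ := exists_first_appearance f ha
    refine Finset.card_pos.2 ⟨m, ?_⟩
    simp only [Finset.mem_filter]
    exact ⟨hmS, fun c hc hlt heq => absurd (hm c hc (heq.trans hma)) (not_le.2 hlt), hm⟩
  · conv_lhs => unfold appearanceLabel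
    refine Finset.card_le_card_of_injOn (appearanceLabel S f)
      (fun b hb => Finset.mem_coe.2 (Finset.mem_image_of_mem _ (Finset.mem_filter.1 hb).1)) ?_
    intro b hb c hc hbc
    have hb' := Finset.mem_filter.1 hb
    have hc' := Finset.mem_filter.1 hc
    have hf := (appearanceLabel_eq_iff hb'.1 hc'.1).1 hbc
    rcases lt_trichotomy b c with hlt | heq | hlt
    · exact absurd hf (hc'.2.1 b hb'.1 hlt)
    · exact heq
    · exact absurd hf.symm (hb'.2.1 c hc'.1 hlt)

end Labels

/-! ### Tie probabilities in a one-level urn. -/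

section Ties

/-- Since ζ factors through κ, different values of ζ have disjoint images under κ. In use, κ gives
the subgroup of a node and ζ its group, so each subgroup is summed in exactly one group. -/
theorem sum_image_univ_fiberwise {A ι M : Type*} [Fintype A] [DecidableEq ι] [AddCommMonoid M]
    {κ : A → ι} {ζ : A → ℕ} (hκζ : ∀ a b, κ a = κ b → ζ a = ζ b) {T : Finset ℕ}
    (hT : ∀ a, ζ a ∈ T) (F : ι → M) :
    ∑ i ∈ Finset.univ.image κ, F i
      = ∑ h ∈ T, ∑ i ∈ (Finset.univ.filter fun a => ζ a = h).image κ, F i := by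
  rw [← Finset.sum_biUnion]
  · congr 1
    ext i
    simp only [Finset.mem_image, Finset.mem_univ, true_and, Finset.mem_biUnion, Finset.mem_filter]
    constructor
    · rintro ⟨a, rfl⟩
      exact ⟨ζ a, hT a, a, rfl, rfl⟩
    · rintro ⟨-, -, a, -, rfl⟩
      exact ⟨a, rfl⟩
  · intro h _ h' _ hne
    refine Finset.disjoint_left.2 fun i hi hi' => hne ?_
    obtain ⟨a, ha, rfl⟩ := Finset.mem_image.1 hi
    obtain ⟨b, hb, hab⟩ := Finset.mem_image.1 hi'
    rw [← (Finset.mem_filter.1 ha).2, ← (Finset.mem_filter.1 hb).2]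
    exact hκζ _ _ hab.symm

/-- The configurations `x` whose ties along `κ` are those prescribed by `ζ`. -/
def tiePattern {ι A : Type*} (α : Type*) (κ : A → ι) (ζ : A → ℕ) : Set (ι → α) :=
  {x | ∀ a b, x (κ a) = x (κ b) ↔ ζ a = ζ b}

theorem dependsOn_tiePattern {α ι A : Type*} [Fintype A] [DecidableEq ι] (κ : A → ι) (ζ : A → ℕ) :
    DependsOn (· ∈ tiePattern α κ ζ) ((Finset.univ.image κ : Finset ι) : Set ι) := by
  intro x y hxy
  have h : ∀ a, x (κ a) = y (κ a) := fun a => hxy _ (by simp)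
  simp only [tiePattern, Set.mem_ofPred_eq, h]

variable {Ω α ι : Type*} [MeasurableSpace Ω] [MeasurableSpace α] {μ : Measure Ω}

/-- In an urn scheme with diffuse base measure, the probability that a new variable ties with a
given earlier one, jointly with an event of the past. -/
theorem IsUrnSample.measure_tie [IsFiniteMeasure μ] [MeasurableEq α] {θ : ENNReal} (hθ : θ ≠ ⊤)
    {G : Measure α} [IsFiniteMeasure G] [NullSingletonClass G] {y : ι → Ω → α}
    (h : IsUrnSample μ θ (fun _ => ()) (fun _ => G) y) {S : Finset ι} {b c : ι} (hb : b ∈ S)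
    (hc : c ∉ S) {Z : Set (ι → α)} (hZ : MeasurableSet Z) (hdep : DependsOn (· ∈ Z) (S : Set ι)) :
    (θ + S.card) * μ {ω | (fun i => y i ω) ∈ Z ∧ y b ω = y c ω}
      = ∑ a ∈ S, μ {ω | (fun i => y i ω) ∈ Z ∧ y b ω = y a ω} := by
  classical
  have hy : Measurable fun ω i => y i ω := measurable_pi_lambda _ h.measurable
  have hset : MeasurableSet {p : (ι → α) × α | p.1 ∈ Z ∧ p.1 b = p.2} :=
    (measurable_fst hZ).inter
      (measurableSet_eq_fun ((measurable_pi_apply b).comp measurable_fst) measurable_snd)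
  have key := h.lintegral hθ hc
    (F := fun s x => Set.indicator {p : (ι → α) × α | p.1 ∈ Z ∧ p.1 b = p.2} 1 (s, x))
    (measurable_one.indicator hset) (fun x s s' hs => by
      have h1 : s ∈ Z ↔ s' ∈ Z := iff_of_eq (hdep hs)
      have h2 := hs b hb
      simp only [Set.indicator, Set.mem_ofPred_eq, h1, h2, Pi.one_apply])
  have hev : ∀ a, ∫⁻ ω, Set.indicator {p : (ι → α) × α | p.1 ∈ Z ∧ p.1 b = p.2} 1
      ((fun i => y i ω), y a ω) ∂μ = μ {ω | (fun i => y i ω) ∈ Z ∧ y b ω = y a ω} := by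
    intro a
    have hm : MeasurableSet {ω | (fun i => y i ω) ∈ Z ∧ y b ω = y a ω} :=
      (hy hZ).inter (measurableSet_eq_fun (h.measurable b) (h.measurable a))
    rw [← lintegral_indicator_one hm]
    rfl
  -- A fresh draw from a diffuse measure almost surely misses the given value, so only the copying
  -- terms survive.
  have hnull : ∀ ω, ∫⁻ x, Set.indicator {p : (ι → α) × α | p.1 ∈ Z ∧ p.1 b = p.2} 1
      ((fun i => y i ω), x) ∂G = 0 := by
    intro ω
    have hae : ∀ᵐ x ∂G, x ≠ y b ω := Measure.ae_ne G (y b ω)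
    rw [lintegral_congr_ae (hae.mono fun x hx => ?_), lintegral_zero]
    exact Set.indicator_of_notMem (fun hp => hx hp.2.symm) _
  simpa only [Finset.filter_true, hev, hnull, lintegral_zero, mul_zero, zero_add] using key

variable {A : Type*}

theorem measurableSet_tiePattern [Finite A] [MeasurableEq α] (κ : A → ι) (ζ : A → ℕ) :
    MeasurableSet (tiePattern α κ ζ) := by
  simp only [tiePattern, Set.ofPred_forall]
  refine MeasurableSet.iInter fun a => MeasurableSet.iInter fun b => ?_
  have := measurableSet_eq_fun (measurable_pi_apply (X := fun _ : ι => α) (κ a))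
    (measurable_pi_apply (κ b))
  by_cases h : ζ a = ζ b
  · simpa [h] using this
  · simp only [h, iff_false]
    exact this.compl

/-- The indices enter only through their coincidences: κ a ↦ κ' a is a well-defined injection on the
range of κ, and re-indexing a conditionally iid sample along an injection preserves its law. -/
theorem IsCondIID.measure_tiePattern_congr [Finite A] [MeasurableEq α] [IsFiniteMeasure μ] {P : Kernel Ω α} {y : ι → Ω → α}
    (h : IsCondIID μ P y)
    (hy : ∀ i, Measurable (y i)) {κ κ' : A → ι} {ζ : A → ℕ} (hκ : ∀ a b, κ a = κ b ↔ κ' a = κ' b) :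
    μ {ω | (fun i => y i ω) ∈ tiePattern α κ ζ} = μ {ω | (fun i => y i ω) ∈ tiePattern α κ' ζ} := by
  let e : Set.range κ → ι := fun i => κ' i.2.choose
  have he : ∀ a, e ⟨κ a, a, rfl⟩ = κ' a := fun a =>
    (hκ _ _).1 (Exists.choose_spec (⟨a, rfl⟩ : κ a ∈ Set.range κ))
  have hinj : Function.Injective e := by
    rintro ⟨_, a, rfl⟩ ⟨_, b, rfl⟩ hab
    rw [he, he] at hab
    exact Subtype.ext ((hκ a b).2 hab)
  have hmap := IsCondIID.map_eq (fun i : Set.range κ => hy i) (fun i => hy (e i))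
    (h.comp_injective Subtype.val_injective) (h.comp_injective hinj)
  have hset := measurableSet_tiePattern (α := α) (fun a => (⟨κ a, a, rfl⟩ : Set.range κ)) ζ
  have := congrArg (· (tiePattern α (fun a => (⟨κ a, a, rfl⟩ : Set.range κ)) ζ)) hmap
  simp only [Measure.map_apply (measurable_pi_lambda _ fun i : Set.range κ => hy i) hset,
    Measure.map_apply (measurable_pi_lambda _ fun i : Set.range κ => hy (e i)) hset] at this
  simpa [tiePattern, Set.preimage, he] using this

variable [Fintype A] [DecidableEq ι] [IsFiniteMeasure μ] [MeasurableEq α] {θ : ENNReal} {G : Measure α}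
  [IsFiniteMeasure G] [NullSingletonClass G] {y : ι → Ω → α} {κ : A → ι} {ζ : A → ℕ}

/-- On the pattern, an old index ties with κ b exactly when it lies in the group of b. Each copying
term is thus the full probability of the pattern or 0, and the nonzero ones are counted by distinct
indices in that group. -/
theorem IsUrnSample.measure_tiePattern_tie (hθ : θ ≠ ⊤)
    (h : IsUrnSample μ θ (fun _ => ()) (fun _ => G) y)
    {c : ι} (hc : c ∉ Finset.univ.image κ) (b : A) :
    (θ + (Finset.univ.image κ).card) *
        μ {ω | (fun i => y i ω) ∈ tiePattern α κ ζ ∧ y (κ b) ω = y c ω}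
      = ((Finset.univ.filter fun a => ζ a = ζ b).image κ).card *
        μ {ω | (fun i => y i ω) ∈ tiePattern α κ ζ} := by
  rw [h.measure_tie hθ (Finset.mem_image_of_mem κ (Finset.mem_univ b)) hc
    (measurableSet_tiePattern κ ζ) (dependsOn_tiePattern κ ζ)]
  rw [← Finset.sum_subset (Finset.image_subset_image (Finset.subset_univ
    (Finset.univ.filter fun a => ζ a = ζ b)))]
  · rw [← nsmul_eq_mul, ← Finset.sum_const]
    refine Finset.sum_congr rfl fun a ha => ?_
    obtain ⟨a, ha', rfl⟩ := Finset.mem_image.1 ha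
    congr 1
    ext ω
    simp only [Set.mem_ofPred_eq, and_iff_left_iff_imp]
    exact fun hω => (hω b a).2 (Finset.mem_filter.1 ha').2.symm
  · intro a ha ha'
    obtain ⟨a, -, rfl⟩ := Finset.mem_image.1 ha
    convert measure_empty (μ := μ)
    ext ω
    simp only [Set.mem_ofPred_eq, Set.mem_empty_iff_false, iff_false, not_and]
    refine fun hω heq => ha' (Finset.mem_image_of_mem κ ?_)
    simpa using ((hω b a).1 heq).symm

/-- With c added to the past, c' ties with c either by copying c or by copying an old index that c
ties with. The first term gives θ + |κ|, after multiplication by that factor. For the second, each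
of the m_h old indices of group h contributes m_h by the previous lemma, giving ∑ m_h². -/
theorem IsUrnSample.measure_tiePattern_tie_new (hθ : θ ≠ ⊤)
    (h : IsUrnSample μ θ (fun _ => ()) (fun _ => G) y)
    (hκζ : ∀ a b, κ a = κ b → ζ a = ζ b) {c c' : ι} (hcc' : c ≠ c')
    (hc : c ∉ Finset.univ.image κ) (hc' : c' ∉ Finset.univ.image κ)
    {T : Finset ℕ} (hT : ∀ a, ζ a ∈ T) :
    (θ + (Finset.univ.image κ).card) * ((θ + (Finset.univ.image κ).card + 1) *
        μ {ω | (fun i => y i ω) ∈ tiePattern α κ ζ ∧ y c ω = y c' ω})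
      = (θ + (Finset.univ.image κ).card +
          ∑ h ∈ T, (((Finset.univ.filter fun a => ζ a = h).image κ).card : ENNReal) *
            ((Finset.univ.filter fun a => ζ a = h).image κ).card) *
        μ {ω | (fun i => y i ω) ∈ tiePattern α κ ζ} := by
  have hdep : DependsOn (· ∈ tiePattern α κ ζ) ((insert c (Finset.univ.image κ) : Finset ι) : Set ι) :=
    fun x y hxy => dependsOn_tiePattern κ ζ fun i hi => hxy i (by
      simpa using Or.inr (by simpa using hi))
  have h1 := h.measure_tie hθ (Finset.mem_insert_self c _)
    (c := c') (by simpa [hcc'.symm] using hc') (measurableSet_tiePattern κ ζ) hdep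
  rw [Finset.card_insert_of_notMem hc, Nat.cast_add, Nat.cast_one, ← add_assoc,
    Finset.sum_insert hc] at h1
  rw [h1, mul_add, add_mul _ (∑ h ∈ T, _)]
  congr 1
  · simp
  · rw [sum_image_univ_fiberwise hκζ hT, Finset.mul_sum, Finset.sum_mul]
    refine Finset.sum_congr rfl fun k _ => ?_
    rw [Finset.mul_sum, mul_assoc, ← nsmul_eq_mul, ← Finset.sum_const]
    refine Finset.sum_congr rfl fun i hi => ?_
    obtain ⟨a, ha, rfl⟩ := Finset.mem_image.1 hi
    have h2 := h.measure_tiePattern_tie (ζ := ζ) hθ hc a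
    rw [(Finset.mem_filter.1 ha).2] at h2
    rw [← h2]
    simp_rw [eq_comm (a := y c _)]

end Ties

/-! ### Two steps of the layered urn. -/

section TwoSteps

variable {Ω T : Type*} [MeasurableSpace Ω] [MeasurableSpace T] {μ : Measure Ω} {N d : ℕ}

/-- Integration over two nodes of an urn sample, given the values of the integrand in each of the
five ways in which the two nodes may tie with the others and with each other. -/
theorem IsUrnSample.lintegral_two_nodes [IsFiniteMeasure μ] {θ : ENNReal} (hθ : θ ≠ ⊤)
    {lay : Fin N → Fin d} {G : Fin d → Measure T} [∀ j, IsProbabilityMeasure (G j)]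
    {t : Fin N → Ω → T} (h : IsUrnSample μ θ lay G t) {v u : Fin N} (hvu : v ≠ u)
    {f w : (Fin N → T) → ENNReal} (hf : Measurable f) (hw : Measurable w)
    {cA : Fin N → Fin N → ENNReal} {cV cU : Fin N → ENNReal} {cC cD : ENNReal}
    (hA : ∀ τ, ∀ a ∈ others v u, ∀ b ∈ others v u, lay a = lay v → lay b = lay u →
      f (Function.update (Function.update τ v (τ a)) u (τ b)) = cA a b * w τ)
    (hV : ∀ τ, ∀ a ∈ others v u, lay a = lay v →
      ∀ᵐ y ∂G (lay u), f (Function.update (Function.update τ v (τ a)) u y) = cV a * w τ)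
    (hU : ∀ τ, ∀ b ∈ others v u, lay b = lay u →
      ∀ᵐ x ∂G (lay v), f (Function.update (Function.update τ v x) u (τ b)) = cU b * w τ)
    (hC : lay v = lay u → ∀ τ x,
      f (Function.update (Function.update τ v x) u x) = cC * w τ)
    (hD : ∀ τ, ∀ᵐ x ∂G (lay v), ∀ᵐ y ∂G (lay u),
      f (Function.update (Function.update τ v x) u y) = cD * w τ) :
    (θ + ((others v u).filter fun a => lay a = lay v).card) *
        ((θ + (((others v u).filter fun a => lay a = lay u).card +
          if lay v = lay u then 1 else 0)) * ∫⁻ ω, f (fun a => t a ω) ∂μ)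
      = ((∑ b ∈ (others v u).filter (fun a => lay a = lay u),
            ∑ a ∈ (others v u).filter (fun a => lay a = lay v), cA a b)
          + θ * ∑ a ∈ (others v u).filter (fun a => lay a = lay v), cV a
          + θ * ∑ b ∈ (others v u).filter (fun a => lay a = lay u), cU b
          + (if lay v = lay u then
              (θ + ((others v u).filter fun a => lay a = lay v).card) * cC else 0)
          + θ * θ * cD) * ∫⁻ ω, w (fun a => t a ω) ∂μ := by
  have hOv : ∀ a ∈ others v u, a ≠ v := fun a ha => by
    rintro rfl
    simp [others] at ha
  have hvO : v ∉ others v u := fun hv => hOv v hv rfl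
  have ht : Measurable fun ω a => t a ω := measurable_pi_lambda _ h.measurable
  have hwt : Measurable fun ω => w fun a => t a ω := hw.comp ht
  have hupd : Measurable fun p : ((Fin N → T) × T) × T =>
      Function.update (Function.update p.1.1 v p.1.2) u p.2 := by
    refine measurable_pi_lambda _ fun a => ?_
    by_cases hau : a = u
    · subst hau
      simpa using measurable_snd
    · by_cases hav : a = v
      · subst hav
        simp only [Function.update_of_ne hau, Function.update_self]
        fun_prop
      · simp only [Function.update_of_ne hau, Function.update_of_ne hav]
        fun_prop
  -- The labels of v and u become free arguments, so that g depends on τ through the other nodes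
  -- only and the urn rule applies with past `others v u`.
  set g : (Fin N → T) → T → T → ENNReal := fun τ x y =>
    f (Function.update (Function.update τ v x) u y) with hg
  have hgm : Measurable fun p : ((Fin N → T) × T) × T => g p.1.1 p.1.2 p.2 := hf.comp hupd
  have hgdep : ∀ x y, DependsOn (g · x y) (others v u : Set (Fin N)) := by
    intro x y τ τ' hτ
    simp only [hg]
    congr 1
    ext a
    by_cases hau : a = u
    · subst hau; simp
    · by_cases hav : a = v
      · subst hav; simp [hau]
      · simp only [Function.update_of_ne hau, Function.update_of_ne hav]
        exact hτ a (by simp [others, hau, hav])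
  have hself : ∀ (τ : Fin N → T) y, g τ (τ v) y = f (Function.update τ u y) := fun τ y => by
    simp [hg]
  -- the second node, given all the others
  have step₁ := h.lintegral hθ (S := {u}ᶜ) (v := u) (by simp) (F := fun τ y => g τ (τ v) y)
    (hgm.comp ((measurable_fst.prodMk ((measurable_pi_apply v).comp measurable_fst)).prodMk
      measurable_snd)) (by
      intro y τ τ' hτ
      simp only [hself]
      congr 1
      ext a
      by_cases hau : a = u
      · subst hau; simp
      · simpa [hau] using hτ a (by simpa using hau))
  have hfull : ∀ ω, g (fun a => t a ω) (t v ω) (t u ω) = f fun a => t a ω := fun ω => by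
    simp [hself (fun a => t a ω)]
  simp only [hfull] at step₁
  -- The nodes that u may copy include v exactly when the layers agree; this produces the extra 1 in
  -- the denominator and the `cC` term.
  have hfilter : ({u}ᶜ : Finset (Fin N)).filter (fun a => lay a = lay u)
      = (if lay v = lay u then {v} else ∅) ∪ (others v u).filter fun a => lay a = lay u := by
    ext a
    by_cases hav : a = v
    · subst hav
      split_ifs with hl <;> simp [hl, hvu]
    · split_ifs <;> simp [others, hav]
  have hdisj : Disjoint (if lay v = lay u then {v} else ∅ : Finset (Fin N))
      ((others v u).filter fun a => lay a = lay u) := by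
    split_ifs <;> simp
  rw [hfilter, Finset.card_union_of_disjoint hdisj, Finset.sum_union hdisj] at step₁
  have hcard : (((if lay v = lay u then {v} else ∅ : Finset (Fin N)).card +
      ((others v u).filter fun a => lay a = lay u).card : ℕ) : ENNReal)
      = ((others v u).filter fun a => lay a = lay u).card + if lay v = lay u then 1 else 0 := by
    split_ifs <;> simp [add_comm]
  rw [hcard] at step₁
  -- the first node, given the nodes other than both
  have stepD := h.lintegral hθ (S := others v u) (v := v) hvO
    (F := fun τ x => ∫⁻ y, g τ x y ∂G (lay u)) hgm.lintegral_prod_right' (by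
      intro x τ τ' hτ
      exact lintegral_congr fun y => hgdep x y hτ)
  have stepU : ∀ b ∈ (others v u).filter fun a => lay a = lay u, _ := fun b hb =>
    h.lintegral hθ (S := others v u) (v := v) hvO (F := fun τ x => g τ x (τ b))
    (hgm.comp (measurable_id.prodMk ((measurable_pi_apply b).comp measurable_fst))) (by
      intro x τ τ' hτ
      dsimp only
      rw [hτ b (Finset.mem_filter.1 hb).1]
      exact hgdep x _ hτ)
  have eD : ∀ τ, ∫⁻ x, ∫⁻ y, g τ x y ∂G (lay u) ∂G (lay v) = cD * w τ := fun τ => by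
    have : ∀ᵐ x ∂G (lay v), ∫⁻ y, g τ x y ∂G (lay u) = cD * w τ := by
      filter_upwards [hD τ] with x hx
      rw [lintegral_congr_ae hx, lintegral_const, measure_univ, mul_one]
    rw [lintegral_congr_ae this, lintegral_const, measure_univ, mul_one]
  have eV : ∀ a ∈ (others v u).filter fun a => lay a = lay v, ∀ τ,
      ∫⁻ y, g τ (τ a) y ∂G (lay u) = cV a * w τ := fun a ha τ => by
    rw [lintegral_congr_ae (hV τ a (Finset.mem_filter.1 ha).1 (Finset.mem_filter.1 ha).2),
      lintegral_const, measure_univ, mul_one]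
  have eU : ∀ b ∈ (others v u).filter fun a => lay a = lay u, ∀ τ,
      ∫⁻ x, g τ x (τ b) ∂G (lay v) = cU b * w τ := fun b hb τ => by
    rw [lintegral_congr_ae (hU τ b (Finset.mem_filter.1 hb).1 (Finset.mem_filter.1 hb).2),
      lintegral_const, measure_univ, mul_one]
  have eA : ∀ a ∈ (others v u).filter (fun a => lay a = lay v),
      ∀ b ∈ (others v u).filter (fun a => lay a = lay u), ∀ τ,
      g τ (τ a) (τ b) = cA a b * w τ := fun a ha b hb τ =>
    hA τ a (Finset.mem_filter.1 ha).1 b (Finset.mem_filter.1 hb).1 (Finset.mem_filter.1 ha).2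
      (Finset.mem_filter.1 hb).2
  set I := ∫⁻ ω, w (fun a => t a ω) ∂μ with hI
  have hc : ∀ c : ENNReal, ∫⁻ ω, c * w (fun a => t a ω) ∂μ = c * I := fun c =>
    lintegral_const_mul c hwt
  have rD : (θ + ((others v u).filter fun a => lay a = lay v).card) *
      ∫⁻ ω, ∫⁻ y, g (fun a => t a ω) (t v ω) y ∂G (lay u) ∂μ
      = θ * (cD * I) + ∑ a ∈ (others v u).filter (fun a => lay a = lay v), cV a * I := by
    rw [stepD]
    simp only [eD, hc]
    congr 1
    refine Finset.sum_congr rfl fun a ha => ?_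
    rw [← hc]
    exact lintegral_congr fun ω => eV a ha fun a => t a ω
  have rU : ∀ b ∈ (others v u).filter fun a => lay a = lay u,
      (θ + ((others v u).filter fun a => lay a = lay v).card) *
      ∫⁻ ω, g (fun a => t a ω) (t v ω) (t b ω) ∂μ
      = θ * (cU b * I) + ∑ a ∈ (others v u).filter (fun a => lay a = lay v), cA a b * I := by
    intro b hb
    rw [stepU b hb, ← hc]
    congr 1
    · congr 1
      exact lintegral_congr fun ω => eU b hb fun a => t a ω
    · refine Finset.sum_congr rfl fun a ha => ?_
      rw [← hc]
      exact lintegral_congr fun ω => eA a ha b hb fun a => t a ω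
  -- When u copies v, the value is the same whether v is old or new, so no urn step for v is taken
  -- and the whole factor θ + n remains.
  have rC : lay v = lay u → (θ + ((others v u).filter fun a => lay a = lay v).card) *
      ∫⁻ ω, g (fun a => t a ω) (t v ω) (t v ω) ∂μ
      = (θ + ((others v u).filter fun a => lay a = lay v).card) * cC * I := by
    intro hl
    have : ∀ τ x, g τ x x = cC * w τ := hC hl
    simp only [this, hc, mul_assoc]
  rw [step₁, mul_add, mul_left_comm, rD, mul_add θ, mul_add (θ + _),
    Finset.mul_sum _ _ (θ + _), Finset.mul_sum _ _ (θ + _), Finset.sum_congr rfl rU,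
    Finset.sum_add_distrib]
  have hif : ∑ a ∈ (if lay v = lay u then {v} else ∅ : Finset (Fin N)),
      (θ + ((others v u).filter fun a => lay a = lay v).card) *
        ∫⁻ ω, g (fun a => t a ω) (t v ω) (t a ω) ∂μ
      = (if lay v = lay u then
          (θ + ((others v u).filter fun a => lay a = lay v).card) * cC else 0) * I := by
    split_ifs with hl
    · rw [Finset.sum_singleton, rC hl]
    · simp
  rw [hif]
  simp only [← Finset.sum_mul, ← Finset.mul_sum]
  ring

end TwoSteps

/-! ### Measurability of allocations and attributes. -/

section Measurability

variable {T X : Type*} [MeasurableSpace T] [MeasurableSpace X] [MeasurableEq T] {N d : ℕ}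

theorem measurable_subgroupAlloc (lay : Fin N → Fin d) (a : Fin N) :
    Measurable fun τ : Fin N → T => subgroupAlloc lay τ a := by
  classical
  have heq : ∀ b c : Fin N, MeasurableSet {τ : Fin N → T | τ b = τ c} := fun b c =>
    measurableSet_eq_fun (measurable_pi_apply b) (measurable_pi_apply c)
  unfold subgroupAlloc appearanceLabel
  simp_rw [Finset.card_filter]
  refine Finset.measurable_sum _ fun b _ => Measurable.ite ?_ measurable_const measurable_const
  simp only [Set.ofPred_and, Set.ofPred_forall]
  refine MeasurableSet.inter ?_ ?_
  · exact MeasurableSet.iInter fun c => MeasurableSet.iInter fun _ => MeasurableSet.iInter fun _ =>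
      (heq c b).compl
  · refine MeasurableSet.iInter fun c => MeasurableSet.iInter fun _ => ?_
    by_cases hbc : b ≤ c
    · simp [hbc]
    · simp only [hbc, imp_false]
      exact (heq c a).compl

theorem measurable_latentAttr (lay : Fin N → Fin d) (a : Fin N) :
    Measurable fun p : (Fin N → T) × (Fin d × ℕ → X) => latentAttr lay p.1 p.2 a := by
  -- Evaluation at a random index is measurable because the index set is countable.
  have h1 : Measurable fun q : (Fin d × ℕ) × (Fin d × ℕ → X) => q.2 q.1 :=
    measurable_from_prod_countable_right fun k => measurable_pi_apply k
  exact h1.comp ((measurable_const.prodMk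
    ((measurable_subgroupAlloc lay a).comp measurable_fst)).prodMk measurable_snd)

end Measurability

/-! ### Counting nodes and subgroups. -/

section Counting

theorem card_image_congr {A B C : Type*} [DecidableEq B] [DecidableEq C] {S : Finset A}
    {f : A → B} {g : A → C} (h : ∀ a ∈ S, ∀ b ∈ S, f a = f b ↔ g a = g b) :
    (S.image f).card = (S.image g).card := by
  have hf : ((S.image fun a => (f a, g a)).image Prod.fst).card
      = (S.image fun a => (f a, g a)).card := Finset.card_image_of_injOn (by
    intro x hx y hy hxy
    obtain ⟨a, ha, rfl⟩ := Finset.mem_image.1 hx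
    obtain ⟨b, hb, rfl⟩ := Finset.mem_image.1 hy
    exact Prod.ext hxy ((h a ha b hb).1 hxy))
  have hg : ((S.image fun a => (f a, g a)).image Prod.snd).card
      = (S.image fun a => (f a, g a)).card := Finset.card_image_of_injOn (by
    intro x hx y hy hxy
    obtain ⟨a, ha, rfl⟩ := Finset.mem_image.1 hx
    obtain ⟨b, hb, rfl⟩ := Finset.mem_image.1 hy
    exact Prod.ext ((h a ha b hb).2 hxy) hxy)
  rw [Finset.image_image] at hf hg
  exact hf.trans hg.symm

variable {N d : ℕ} {S : Finset (Fin N)}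

theorem subgroupTotal_eq_card (lay : Fin N → Fin d) (z w : S → ℕ) (h : ℕ) :
    subgroupTotal lay z w h
      = ((Finset.univ.filter fun a => z a = h).image fun a : S => (lay a, w a)).card := by
  rw [Finset.card_eq_sum_card_fiberwise (f := Prod.fst) (t := Finset.univ) fun _ _ => by simp]
  refine Finset.sum_congr rfl fun j _ => ?_
  rw [subgroupCount, ← Finset.card_image_of_injective _ (Prod.mk_right_injective j),
    Finset.image_image]
  congr 1
  ext p
  simp only [Finset.mem_image, Finset.mem_filter, Finset.mem_univ, true_and, Function.comp]
  constructor
  · rintro ⟨a, ⟨hj, hz⟩, rfl⟩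
    exact ⟨⟨a, hz, by rw [hj]⟩, rfl⟩
  · rintro ⟨⟨a, hz, rfl⟩, rfl⟩
    exact ⟨a, ⟨rfl, hz⟩, rfl⟩

theorem subgroupCard_eq_sum (lay : Fin N → Fin d) (z w : S → ℕ) :
    subgroupCard lay z w = ∑ h ∈ Finset.Icc 1 (numGroups z), subgroupTotal lay z w h :=
  Finset.sum_comm

/-- By `hzw` no subgroup is split between groups, so counting group by group counts every subgroup
once. -/
theorem subgroupCard_eq_card {lay : Fin N → Fin d} {z w : S → ℕ}
    (hzw : ∀ a b : S, (lay a, w a) = (lay b, w b) → z a = z b)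
    (hz : ∀ a, z a ∈ Finset.Icc 1 (numGroups z)) :
    subgroupCard lay z w = (Finset.univ.image fun a : S => (lay a, w a)).card := by
  rw [subgroupCard_eq_sum, Finset.card_eq_sum_ones, sum_image_univ_fiberwise hzw hz]
  simp_rw [← Finset.card_eq_sum_ones, subgroupTotal_eq_card]

/-- Summation over the nodes of a layer, grouped by the groups they are allocated to. -/
theorem sum_layer_eq_sum_nodeCount {M : Type*} [CommSemiring M] (lay : Fin N → Fin d)
    {z : S → ℕ} (hz : ∀ a, z a ∈ Finset.Icc 1 (numGroups z)) {z' : Fin N → ℕ}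
    (hz' : ∀ a : S, z' a = z a) (j : Fin d) (φ : ℕ → M) :
    ∑ a ∈ S.filter (fun a => lay a = j), φ (z' a)
      = ∑ h ∈ Finset.Icc 1 (numGroups z), (nodeCount lay z j h : M) * φ h := by
  rw [← Finset.sum_fiberwise_of_maps_to (g := z') (t := Finset.Icc 1 (numGroups z)) fun a ha => by
    have := hz ⟨a, (Finset.mem_filter.1 ha).1⟩
    rwa [← hz' ⟨a, _⟩] at this]
  refine Finset.sum_congr rfl fun h _ => ?_
  rw [Finset.sum_congr rfl (g := fun _ => φ h) fun a ha => by rw [(Finset.mem_filter.1 ha).2],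
    Finset.sum_const, nsmul_eq_mul, Finset.filter_filter]
  congr 2
  rw [nodeCount, ← Finset.card_map (Function.Embedding.subtype _)]
  congr 1
  ext a
  simp only [Finset.mem_filter, Finset.mem_map, Finset.mem_univ, true_and,
    Function.Embedding.subtype_apply, Subtype.exists, exists_and_right, exists_eq_right]
  constructor
  · rintro ⟨ha, hj, hh⟩
    exact ⟨ha, hj, (hz' ⟨a, ha⟩).symm.trans hh⟩
  · rintro ⟨ha, hj, hh⟩
    exact ⟨ha, hj, (hz' ⟨a, ha⟩).trans hh⟩

theorem layerSize_eq_card_others (lay : Fin N → Fin d) {v u : Fin N} (hvu : v ≠ u) (j : Fin d) :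
    layerSize lay j = ((others v u).filter fun a => lay a = j).card +
      (if lay v = j then 1 else 0) + if lay u = j then 1 else 0 := by
  unfold layerSize
  simp only [Finset.card_filter, others]
  rw [← Finset.sum_compl_add_sum {v, u}, Finset.sum_pair hvu, add_assoc]

end Counting

/-! ### Reduced allocations as tie patterns. -/

section Allocations

variable {T X : Type*} {N d : ℕ} {lay : Fin N → Fin d} {v u : Fin N}

theorem subgroupAlloc_eq_iff (τ : Fin N → T) {a b : Fin N} (hl : lay a = lay b) :
    subgroupAlloc lay τ a = subgroupAlloc lay τ b ↔ τ a = τ b := by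
  unfold subgroupAlloc
  rw [hl]
  exact appearanceLabel_eq_iff (by simp [hl]) (by simp)

/-- The subgroup of a node: its layer and its number within the layer. -/
def subgroupIndex (lay : Fin N → Fin d) (τ : Fin N → T) (a : Fin N) : Fin d × ℕ :=
  (lay a, subgroupAlloc lay τ a)

theorem subgroupIndex_eq_iff (τ : Fin N → T) (a b : Fin N) :
    subgroupIndex lay τ a = subgroupIndex lay τ b ↔ lay a = lay b ∧ τ a = τ b := by
  unfold subgroupIndex
  rw [Prod.mk.injEq]
  exact and_congr_right fun hl => subgroupAlloc_eq_iff τ hl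

theorem groupAlloc_eq_iff (τ : Fin N → T) (x : Fin d × ℕ → X) (a b : Fin N) :
    groupAlloc lay τ x a = groupAlloc lay τ x b ↔
      x (subgroupIndex lay τ a) = x (subgroupIndex lay τ b) :=
  appearanceLabel_eq_iff (Finset.mem_univ a) (Finset.mem_univ b)

/-- An order-of-appearance labelling is determined by its ties. The realization (τ₀, x₀) certifies
that ζ is such a labelling, so having the ties of ζ is enough to recover ζ itself. -/
theorem removeZ_eq_iff {τ₀ : Fin N → T} {x₀ : Fin d × ℕ → X} {ζ : others v u → ℕ}
    (h₀ : removeZ v u (groupAlloc lay τ₀ x₀) = ζ) (τ : Fin N → T) (x : Fin d × ℕ → X) :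
    removeZ v u (groupAlloc lay τ x) = ζ ↔
      x ∈ tiePattern X (fun a : others v u => subgroupIndex lay τ a) ζ := by
  have hiff : ∀ (τ : Fin N → T) (x : Fin d × ℕ → X) (a b : others v u),
      removeZ v u (groupAlloc lay τ x) a = removeZ v u (groupAlloc lay τ x) b ↔
        x (subgroupIndex lay τ a) = x (subgroupIndex lay τ b) := fun τ x a b =>
    (appearanceLabel_eq_iff a.2 b.2).trans (groupAlloc_eq_iff τ x a b)
  constructor
  · rintro rfl
    exact fun a b => (hiff τ x a b).symm
  · intro hx
    rw [← h₀] at hx ⊢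
    ext a
    refine appearanceLabel_congr a.2 fun b hb c hc => ?_
    rw [groupAlloc_eq_iff, groupAlloc_eq_iff, hx ⟨b, hb⟩ ⟨c, hc⟩, hiff]

/-- The label vectors whose ties within layers, off the nodes `v, u`, are those of `ϖ`. -/
def subgroupPattern (T : Type*) (lay : Fin N → Fin d) {v u : Fin N} (ϖ : others v u → ℕ) :
    Set (Fin N → T) :=
  {τ | ∀ a b : others v u, lay a = lay b → (τ a = τ b ↔ ϖ a = ϖ b)}

theorem removeW_eq_iff {τ₀ : Fin N → T} {ϖ : others v u → ℕ}
    (h₀ : removeW lay v u (subgroupAlloc lay τ₀) = ϖ) (τ : Fin N → T) :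
    removeW lay v u (subgroupAlloc lay τ) = ϖ ↔ τ ∈ subgroupPattern T lay ϖ := by
  have hiff : ∀ (τ : Fin N → T) (a b : others v u), lay a = lay b →
      (removeW lay v u (subgroupAlloc lay τ) a = removeW lay v u (subgroupAlloc lay τ) b ↔
        τ a = τ b) := fun τ a b hl => by
    unfold removeW
    rw [hl]
    have ha : (a : Fin N) ∈ (others v u).filter fun c => lay c = lay b := by
      rw [Finset.mem_filter]
      exact ⟨a.2, hl⟩
    have hb : (b : Fin N) ∈ (others v u).filter fun c => lay c = lay b := by
      rw [Finset.mem_filter]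
      exact ⟨b.2, rfl⟩
    rw [appearanceLabel_eq_iff ha hb, subgroupAlloc_eq_iff τ hl]
  constructor
  · rintro rfl
    exact fun a b hl => (hiff τ a b hl).symm
  · intro hτ
    rw [← h₀] at hτ ⊢
    ext a
    have ha : (a : Fin N) ∈ (others v u).filter fun c => lay c = lay a := by
      rw [Finset.mem_filter]
      exact ⟨a.2, rfl⟩
    refine appearanceLabel_congr ha fun b hb c hc => ?_
    obtain ⟨hb, hlb⟩ := Finset.mem_filter.1 hb
    obtain ⟨hc, hlc⟩ := Finset.mem_filter.1 hc
    have hl : lay b = lay c := hlb.trans hlc.symm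
    rw [subgroupAlloc_eq_iff τ hl, subgroupAlloc_eq_iff τ₀ hl, hτ ⟨b, hb⟩ ⟨c, hc⟩ hl,
      hiff τ₀ ⟨b, hb⟩ ⟨c, hc⟩ hl]

theorem removeZ_mem_Icc (z : Fin N → ℕ) (a : others v u) :
    removeZ v u z a ∈ Finset.Icc 1 (numGroups (removeZ v u z)) := by
  have h := appearanceLabel_mem_Icc z a.2
  have himage : Finset.univ.image (removeZ v u z)
      = (others v u).image (appearanceLabel (others v u) z) := by
    ext n
    simp only [Finset.mem_image, Finset.mem_univ, true_and, Subtype.exists, removeZ]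
    exact ⟨fun ⟨a, ha, h⟩ => ⟨a, ha, h⟩, fun ⟨a, ha, h⟩ => ⟨a, ha, h⟩⟩
  rw [numGroups, himage]
  exact h

theorem measurableSet_subgroupPattern [MeasurableSpace T] [MeasurableEq T]
    (ϖ : others v u → ℕ) : MeasurableSet (subgroupPattern T lay ϖ) := by
  simp only [subgroupPattern, Set.ofPred_forall]
  refine MeasurableSet.iInter fun a => MeasurableSet.iInter fun b => MeasurableSet.iInter fun _ => ?_
  have := measurableSet_eq_fun (measurable_pi_apply (X := fun _ : Fin N => T) a)
    (measurable_pi_apply (b : Fin N))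
  by_cases h : ϖ a = ϖ b
  · simpa [h] using this
  · simp only [h, iff_false]
    exact this.compl

theorem update_mem_subgroupPattern {ϖ : others v u → ℕ} (τ : Fin N → T) (x y : T) :
    Function.update (Function.update τ v x) u y ∈ subgroupPattern T lay ϖ ↔
      τ ∈ subgroupPattern T lay ϖ := by
  have h : ∀ a : others v u, Function.update (Function.update τ v x) u y a = τ a := fun a => by
    have ha := a.2
    simp only [others, Finset.mem_compl, Finset.mem_insert, Finset.mem_singleton, not_or] at ha
    rw [Function.update_of_ne ha.2, Function.update_of_ne ha.1]
  simp only [subgroupPattern, Set.mem_ofPred_eq, h]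

end Allocations

theorem ENNReal.eq_coe_div_mul {r m : NNReal} (hr : r ≠ 0) {x p : ENNReal}
    (h : (r : ENNReal) * x = m * p) : x = ((m / r : NNReal) : ENNReal) * p := by
  rw [ENNReal.coe_div hr, ENNReal.div_eq_inv_mul, mul_assoc, ← h, ← mul_assoc,
    ENNReal.inv_mul_cancel (by simpa using hr) ENNReal.coe_ne_top, one_mul]

/-! ### The two-level scheme. -/

section HDP

variable {Ω T X : Type*} [MeasurableSpace Ω] [MeasurableSpace T] [MeasurableSpace X]
  {N d : ℕ} {μ : Measure Ω} {lay : Fin N → Fin d} {θ θ₀ : ℝ}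
  {G : Fin d → Measure T} {P₀ : Measure X} {Q : Fin d → Kernel Ω T} {P : Kernel Ω X}
  {t : Fin N → Ω → T} {s : Fin d × ℕ → Ω → X}

theorem IsHDPScheme.isUrnSample_subgroups [∀ j, IsProbabilityMeasure (G j)]
    [∀ j, IsMarkovKernel (Q j)] (h : IsHDPScheme μ lay θ θ₀ G P₀ Q P t s) (hθ : 0 < θ) :
    IsUrnSample μ (ENNReal.ofReal θ) lay G t :=
  isUrnSample_of_layers (fun j => (h.subgroups j).isUrnSample hθ)
    (h.indep_layers.comp (fun _ p => p.2) fun _ => measurable_snd)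

/-- Fubini for the independent levels: with the labels frozen, the subgroup indices are
deterministic and the event concerns the profiles alone. -/
theorem IsHDPScheme.measure_eq_lintegral [IsProbabilityMeasure μ]
    (h : IsHDPScheme μ lay θ θ₀ G P₀ Q P t s)
    {E : Set ((Fin N → T) × (Fin d × ℕ → X))} (hE : MeasurableSet E) :
    μ {ω | ((fun a => t a ω), fun p => s p ω) ∈ E}
      = ∫⁻ ω, μ {ω' | ((fun a => t a ω), fun p => s p ω') ∈ E} ∂μ := by
  have ht : Measurable fun ω a => t a ω :=
    measurable_pi_lambda _ fun a => (h.subgroups (lay a)).measurable ⟨a, rfl⟩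
  have hs : Measurable fun ω p => s p ω := measurable_pi_lambda _ h.profiles.measurable
  have hind : IndepFun (fun ω a => t a ω) (fun ω p => s p ω) μ :=
    h.indep_levels.comp measurable_snd measurable_snd
  have hmap := hind.map_prod_eq_prod_map_map ht.aemeasurable hs.aemeasurable
  have h1 := congrArg (· E) hmap
  simp only [Measure.map_apply (ht.prodMk hs) hE, Measure.prod_apply hE] at h1
  rw [lintegral_map (measurable_measure_prodMk_left hE) ht] at h1
  refine h1.trans (lintegral_congr fun ω => ?_)
  rw [Measure.map_apply hs (measurable_prodMk_left hE)]
  rfl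

theorem measurableSet_tie_event [MeasurableEq T] [MeasurableEq X] {v u : Fin N}
    (ζ ϖ : others v u → ℕ) :
    MeasurableSet {p : (Fin N → T) × (Fin d × ℕ → X) | p.1 ∈ subgroupPattern T lay ϖ ∧
      p.2 ∈ tiePattern X (fun a : others v u => subgroupIndex lay p.1 a) ζ} := by
  refine (measurable_fst (measurableSet_subgroupPattern ϖ)).inter ?_
  have hset : {p : (Fin N → T) × (Fin d × ℕ → X) |
      p.2 ∈ tiePattern X (fun a : others v u => subgroupIndex lay p.1 a) ζ}
      = ⋂ a : others v u, ⋂ b : others v u, {p : (Fin N → T) × (Fin d × ℕ → X) |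
        latentAttr lay p.1 p.2 a = latentAttr lay p.1 p.2 b ↔ ζ a = ζ b} := by
    ext p
    simp only [Set.mem_iInter]
    rfl
  change MeasurableSet {p : (Fin N → T) × (Fin d × ℕ → X) |
      p.2 ∈ tiePattern X (fun a : others v u => subgroupIndex lay p.1 a) ζ}
  rw [hset]
  refine MeasurableSet.iInter fun a => MeasurableSet.iInter fun b => ?_
  have := measurableSet_eq_fun (measurable_latentAttr (T := T) (X := X) lay (a : Fin N))
    (measurable_latentAttr lay (b : Fin N))
  by_cases h : ζ a = ζ b
  · simp only [h, iff_true]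
    exact this
  · simp only [h, iff_false]
    exact this.compl

open Classical in
/-- The joint probability of a pattern of the other nodes and of a tie between `v` and `u`. -/
theorem IsHDPScheme.measure_pattern_tie [MeasurableEq T] [MeasurableEq X] [IsProbabilityMeasure μ]
    [∀ j, IsProbabilityMeasure (G j)] [∀ j, NullSingletonClass (G j)] [IsProbabilityMeasure P₀]
    [NullSingletonClass P₀] [∀ j, IsMarkovKernel (Q j)] [IsMarkovKernel P] {Θ Θ₀ : NNReal}
    (hΘ : Θ ≠ 0) (hΘ₀ : Θ₀ ≠ 0) (h : IsHDPScheme μ lay Θ Θ₀ G P₀ Q P t s)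
    {v u : Fin N} (hvu : v ≠ u) {ζ ϖ : others v u → ℕ}
    (hζϖ : ∀ a b : others v u, (lay a, ϖ a) = (lay b, ϖ b) → ζ a = ζ b)
    (hζ : ∀ a, ζ a ∈ Finset.Icc 1 (numGroups ζ))
    {E : Set ((Fin N → T) × (Fin d × ℕ → X))}
    (hE : E = {p | p.1 ∈ subgroupPattern T lay ϖ ∧
      p.2 ∈ tiePattern X (fun a : others v u => subgroupIndex lay p.1 a) ζ})
    {m : ℕ → NNReal} (hm : ∀ k, m k = subgroupTotal lay ζ ϖ k)
    {M : NNReal} (hM : M = subgroupCard lay ζ ϖ)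
    {ζ' : Fin N → ℕ} (hζ' : ∀ a : others v u, ζ' a = ζ a) :
    (((Θ + ((others v u).filter fun a => lay a = lay v).card) *
        (Θ + (((others v u).filter fun a => lay a = lay u).card +
          if lay v = lay u then 1 else 0)) : NNReal) : ENNReal) *
            μ {ω | ((fun a => t a ω), fun p => s p ω) ∈ E ∧
              s (subgroupIndex lay (fun a => t a ω) v) ω
                = s (subgroupIndex lay (fun a => t a ω) u) ω}
      = ((∑ b ∈ (others v u).filter (fun a => lay a = lay u),
            ∑ a ∈ (others v u).filter (fun a => lay a = lay v), (if ζ' a = ζ' b then 1 else 0)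
          + Θ * ∑ a ∈ (others v u).filter (fun a => lay a = lay v), m (ζ' a) / (Θ₀ + M)
          + Θ * ∑ b ∈ (others v u).filter (fun a => lay a = lay u), m (ζ' b) / (Θ₀ + M)
          + (if lay v = lay u then Θ + ((others v u).filter fun a => lay a = lay v).card else 0)
          + Θ * Θ * ((Θ₀ + M + ∑ k ∈ Finset.Icc 1 (numGroups ζ), m k * m k) /
              ((Θ₀ + M) * (Θ₀ + M + 1))) : NNReal) : ENNReal) *
        μ {ω | ((fun a => t a ω), fun p => s p ω) ∈ E} := by
  have hurn := h.isUrnSample_subgroups (NNReal.coe_pos.2 <| pos_iff_ne_zero.2 hΘ)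
  have hsurn := h.profiles.isUrnSample (NNReal.coe_pos.2 <| pos_iff_ne_zero.2 hΘ₀)
  rw [ENNReal.ofReal_coe_nnreal] at hurn hsurn
  have hsm := h.profiles.measurable
  have hEm : MeasurableSet E := by
    rw [hE]
    exact measurableSet_tie_event ζ ϖ
  have hEm' : MeasurableSet (E ∩ {p | latentAttr lay p.1 p.2 v = latentAttr lay p.1 p.2 u}) :=
    hEm.inter (measurableSet_eq_fun (measurable_latentAttr lay v) (measurable_latentAttr lay u))
  set p := μ {ω | (fun i => s i ω) ∈ tiePattern X (fun a : others v u => (lay a, ϖ a)) ζ} with hp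
  set W := subgroupPattern T lay ϖ with hW
  have hker : ∀ τ ∈ W, ∀ a b : others v u,
      subgroupIndex lay τ a = subgroupIndex lay τ b ↔ (lay a, ϖ a) = (lay b, ϖ b) :=
    fun τ hτ a b => by
      rw [subgroupIndex_eq_iff, Prod.mk.injEq]
      exact and_congr_right fun hl => hτ a b hl
  -- The subgroup numbers depend on τ, including its values at v and u, but their ties are those of
  -- ϖ; exchangeability gives the same probability p for all τ in W.
  have hpat : ∀ τ ∈ W, μ {ω | (fun i => s i ω) ∈
      tiePattern X (fun a : others v u => subgroupIndex lay τ a) ζ} = p := fun τ hτ =>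
    h.profiles.isCondIID.measure_tiePattern_congr hsm (hker τ hτ)
  have hcard : ∀ τ ∈ W, ((Finset.univ.image fun a : others v u => subgroupIndex lay τ a).card : ENNReal)
      = M := fun τ hτ => by
    rw [card_image_congr fun a _ b _ => hker τ hτ a b, ← subgroupCard_eq_card hζϖ hζ, hM]
    simp
  have hcard' : ∀ τ ∈ W, ∀ k, (((Finset.univ.filter fun a => ζ a = k).image
      fun a : others v u => subgroupIndex lay τ a).card : ENNReal) = m k := fun τ hτ k => by
    rw [card_image_congr fun a _ b _ => hker τ hτ a b, ← subgroupTotal_eq_card, hm]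
    simp
  have hcompat : ∀ τ ∈ W, ∀ a b : others v u, subgroupIndex lay τ a = subgroupIndex lay τ b →
      ζ a = ζ b := fun τ hτ a b hab => hζϖ a b ((hker τ hτ a b).1 hab)
  set f : (Fin N → T) → ENNReal := fun τ => μ {ω | (τ, fun i => s i ω) ∈
    E ∩ {p | latentAttr lay p.1 p.2 v = latentAttr lay p.1 p.2 u}} with hf
  set w : (Fin N → T) → ENNReal := fun τ => μ {ω | (τ, fun i => s i ω) ∈ E} with hw
  have hs : Measurable fun ω i => s i ω := measurable_pi_lambda _ hsm
  have hmeas : ∀ E' : Set ((Fin N → T) × (Fin d × ℕ → X)), MeasurableSet E' →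
      Measurable fun τ => μ {ω | (τ, fun i => s i ω) ∈ E'} := fun E' hE' => by
    have := measurable_measure_prodMk_left (ν := μ.map fun ω i => s i ω) hE'
    simp_rw [Measure.map_apply hs (measurable_prodMk_left hE')] at this
    exact this
  have hf0 : ∀ τ, τ ∉ W → f τ = 0 := fun τ hτ => by
    simp only [hf, hE]
    convert measure_empty (μ := μ)
    ext ω
    simp only [Set.mem_ofPred_eq, Set.mem_inter_iff, Set.mem_empty_iff_false, iff_false]
    exact fun hω => hτ hω.1.1
  have hw0 : ∀ τ, τ ∉ W → w τ = 0 := fun τ hτ => by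
    simp only [hw, hE]
    convert measure_empty (μ := μ)
    ext ω
    simp only [Set.mem_ofPred_eq, Set.mem_empty_iff_false, iff_false]
    exact fun hω => hτ hω.1
  have hw1 : ∀ τ ∈ W, w τ = p := fun τ hτ => by
    rw [← hpat τ hτ]
    simp only [hw, hE]
    congr 1
    ext ω
    exact and_iff_right hτ
  have hf1 : ∀ τ ∈ W, f τ = μ {ω | (fun i => s i ω) ∈
      tiePattern X (fun a : others v u => subgroupIndex lay τ a) ζ ∧
      s (subgroupIndex lay τ v) ω = s (subgroupIndex lay τ u) ω} := fun τ hτ => by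
    simp only [hf, hE]
    congr 1
    ext ω
    exact and_congr_left' (and_iff_right hτ)
  -- the values of `f` after relabelling the two nodes
  have hval : ∀ (τ : Fin N → T) (x y : T) (c : ENNReal),
      (∀ σ ∈ W, σ v = x → σ u = y → (∀ a : others v u, σ a = τ a) → f σ = c * p) →
      f (Function.update (Function.update τ v x) u y) = c * w τ := by
    intro τ x y c hc
    have hiff := update_mem_subgroupPattern (lay := lay) (ϖ := ϖ) τ x y
    -- Off the pattern both sides vanish, so c matters only on W.
    by_cases hτ : τ ∈ W
    · rw [hw1 τ hτ]
      refine hc _ (hiff.2 hτ) (by simp [hvu]) (by simp) fun a => ?_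
      have ha := a.2
      simp only [others, Finset.mem_compl, Finset.mem_insert, Finset.mem_singleton, not_or] at ha
      rw [Function.update_of_ne ha.2, Function.update_of_ne ha.1]
    · rw [hw0 τ hτ, mul_zero, hf0 _ fun h' => hτ (hiff.1 h')]
  have hnew : ∀ (j : Fin d) (τ : Fin N → T), ∀ᵐ x ∂G j, ∀ a, x ≠ τ a := fun j τ =>
    ae_all_iff.2 fun a => Measure.ae_ne (G j) (τ a)
  have hnotMem : ∀ (σ τ : Fin N → T) (c : Fin N), (∀ a : others v u, σ a = τ a) →
      (∀ a, σ c ≠ τ a) → subgroupIndex lay σ c ∉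
        Finset.univ.image fun a : others v u => subgroupIndex lay σ a := by
    intro σ τ c hστ hc hmem
    obtain ⟨a, -, ha⟩ := Finset.mem_image.1 hmem
    exact hc a (((subgroupIndex_eq_iff σ _ _).1 ha).2.symm.trans (hστ a))
  have hr : Θ₀ + M ≠ 0 := fun h0 => hΘ₀ (by
    have := add_eq_zero.1 h0
    exact this.1)
  have hr' : Θ₀ + M + 1 ≠ 0 := by positivity
  -- The coefficients are the tie probabilities given the pattern: `cA` with both nodes in old
  -- subgroups, `cV` and `cU` with only v, respectively only u, in an old one, `cC` with a shared
  -- label, `cD` with two fresh ones.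
  have key := hurn.lintegral_two_nodes ENNReal.coe_ne_top hvu (f := f) (w := w)
    (hmeas _ hEm') (hmeas _ hEm)
    (cA := fun a b => ((if ζ' a = ζ' b then 1 else 0 : NNReal) : ENNReal))
    (cV := fun a => ((m (ζ' a) / (Θ₀ + M) : NNReal) : ENNReal))
    (cU := fun a => ((m (ζ' a) / (Θ₀ + M) : NNReal) : ENNReal)) (cC := 1)
    (cD := (((Θ₀ + M + ∑ k ∈ Finset.Icc 1 (numGroups ζ), m k * m k) /
              ((Θ₀ + M) * (Θ₀ + M + 1)) : NNReal) : ENNReal)) ?_ ?_ ?_ ?_ ?_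
  · have e1 := h.measure_eq_lintegral hEm
    have e2 := h.measure_eq_lintegral hEm'
    rw [e1]
    simp only [hf, hw] at key
    have e3 : {ω | ((fun a => t a ω), fun p => s p ω) ∈ E ∧
        s (subgroupIndex lay (fun a => t a ω) v) ω = s (subgroupIndex lay (fun a => t a ω) u) ω}
        = {ω | ((fun a => t a ω), fun p => s p ω) ∈
          E ∩ {p | latentAttr lay p.1 p.2 v = latentAttr lay p.1 p.2 u}} := rfl
    rw [e3, e2]
    by_cases hl : lay v = lay u
    · simp only [hl, if_true, mul_one] at key ⊢
      push_cast at key ⊢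
      rw [← key, mul_assoc]
    · simp only [hl, if_false] at key ⊢
      push_cast at key ⊢
      rw [← key, mul_assoc]
  · intro τ a ha b hb hla hlb
    refine hval τ _ _ _ fun σ hσ hv hu hστ => ?_
    have h1 : subgroupIndex lay σ v = subgroupIndex lay σ a :=
      (subgroupIndex_eq_iff σ _ _).2 ⟨hla.symm, by rw [hv]; exact (hστ ⟨a, ha⟩).symm⟩
    have h2 : subgroupIndex lay σ u = subgroupIndex lay σ b :=
      (subgroupIndex_eq_iff σ _ _).2 ⟨hlb.symm, by rw [hu]; exact (hστ ⟨b, hb⟩).symm⟩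
    rw [hf1 σ hσ, h1, h2, hζ' ⟨a, ha⟩, hζ' ⟨b, hb⟩]
    split_ifs with hab
    · rw [ENNReal.coe_one, one_mul, ← hpat σ hσ]
      congr 1
      ext ω
      exact and_iff_left_of_imp fun hω => (hω ⟨a, ha⟩ ⟨b, hb⟩).2 hab
    · rw [ENNReal.coe_zero, zero_mul]
      convert measure_empty (μ := μ)
      ext ω
      simp only [Set.mem_ofPred_eq, Set.mem_empty_iff_false, iff_false, not_and]
      exact fun hω heq => hab ((hω ⟨a, ha⟩ ⟨b, hb⟩).1 heq)
  · intro τ a ha hla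
    filter_upwards [hnew (lay u) τ] with y hy
    refine hval τ _ _ _ fun σ hσ hv hu hστ => ?_
    have h1 : subgroupIndex lay σ v = subgroupIndex lay σ a :=
      (subgroupIndex_eq_iff σ _ _).2 ⟨hla.symm, by rw [hv]; exact (hστ ⟨a, ha⟩).symm⟩
    have h2 := hsurn.measure_tiePattern_tie (ζ := ζ) ENNReal.coe_ne_top
      (hnotMem σ τ u hστ (by rwa [hu])) ⟨a, ha⟩
    rw [hcard σ hσ, hcard' σ hσ, hpat σ hσ, ← ENNReal.coe_add] at h2
    rw [hf1 σ hσ, h1, hζ' ⟨a, ha⟩]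
    exact ENNReal.eq_coe_div_mul hr h2
  · intro τ b hb hlb
    filter_upwards [hnew (lay v) τ] with x hx
    refine hval τ _ _ _ fun σ hσ hv hu hστ => ?_
    have h1 : subgroupIndex lay σ u = subgroupIndex lay σ b :=
      (subgroupIndex_eq_iff σ _ _).2 ⟨hlb.symm, by rw [hu]; exact (hστ ⟨b, hb⟩).symm⟩
    have h2 := hsurn.measure_tiePattern_tie (ζ := ζ) ENNReal.coe_ne_top
      (hnotMem σ τ v hστ (by rwa [hv])) ⟨b, hb⟩
    rw [hcard σ hσ, hcard' σ hσ, hpat σ hσ, ← ENNReal.coe_add] at h2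
    rw [hf1 σ hσ, h1, hζ' ⟨b, hb⟩]
    simp_rw [eq_comm (a := s (subgroupIndex lay σ v) _)]
    exact ENNReal.eq_coe_div_mul hr h2
  · intro hl τ x
    refine hval τ _ _ _ fun σ hσ hv hu hστ => ?_
    have h1 : subgroupIndex lay σ v = subgroupIndex lay σ u :=
      (subgroupIndex_eq_iff σ _ _).2 ⟨hl, hv.trans hu.symm⟩
    rw [hf1 σ hσ, h1, one_mul, ← hpat σ hσ]
    simp
  · intro τ
    filter_upwards [hnew (lay v) τ] with x hx
    -- The second fresh label must also avoid the first, so that v and u open two different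
    -- subgroups even within one layer.
    filter_upwards [hnew (lay u) τ, Measure.ae_ne (G (lay u)) x] with y hy hyx
    refine hval τ _ _ _ fun σ hσ hv hu hστ => ?_
    have h1 : subgroupIndex lay σ v ≠ subgroupIndex lay σ u := fun h1 =>
      hyx (by rw [← hv, ← hu]; exact ((subgroupIndex_eq_iff σ _ _).1 h1).2.symm)
    have h2 := hsurn.measure_tiePattern_tie_new ENNReal.coe_ne_top (hcompat σ hσ) h1
      (hnotMem σ τ v hστ (by rwa [hv])) (hnotMem σ τ u hστ (by rwa [hu])) hζ
    simp only [hcard σ hσ, hcard' σ hσ, hpat σ hσ] at h2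
    rw [hf1 σ hσ]
    refine ENNReal.eq_coe_div_mul (mul_ne_zero hr hr') ?_
    push_cast
    rw [mul_assoc]
    exact h2

end HDP

end

/-! ### Final algebra and the theorem. -/

/-- Here c is the number of other nodes in the layer: the weight θ + c of u copying v turns ∑ n²
into ∑ n(n + 1) and supplies the lone θ. Similarly L turns ∑ ℓ² into ∑ ℓ(ℓ + 1). -/
theorem inv_mul_eq_of_mul_eq_same_layer {D A B θ θ₀ L c SN SNL SL : ℝ} (hD : D ≠ 0)
    (hr : θ₀ + L ≠ 0) (hr' : θ₀ + L + 1 ≠ 0) (hB : B ≠ 0)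
    (h : D * A = (SN + θ * (SNL / (θ₀ + L)) + θ * (SNL / (θ₀ + L)) + (θ + c) +
      θ * θ * ((θ₀ + L + SL) / ((θ₀ + L) * (θ₀ + L + 1)))) * B) :
    B⁻¹ * A = 1 / D * (SN + c + θ * (1 + 2 / (θ₀ + L) * SNL) +
      θ ^ 2 / ((θ₀ + L) * (θ₀ + L + 1)) * (SL + L + θ₀)) := by
  rw [inv_mul_eq_iff_eq_mul₀ hB, ← mul_right_inj' hD, h]
  field_simp
  ring

theorem inv_mul_eq_of_mul_eq_distinct_layers {D A B θ θ₀ L SN SNL SNL' SL : ℝ} (hD : D ≠ 0)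
    (hr : θ₀ + L ≠ 0) (hr' : θ₀ + L + 1 ≠ 0) (hB : B ≠ 0)
    (h : D * A = (SN + θ * (SNL / (θ₀ + L)) + θ * (SNL' / (θ₀ + L)) + 0 +
      θ * θ * ((θ₀ + L + SL) / ((θ₀ + L) * (θ₀ + L + 1)))) * B) :
    B⁻¹ * A = 1 / D * (SN + θ / (θ₀ + L) * (SNL + SNL') +
      θ ^ 2 / ((θ₀ + L) * (θ₀ + L + 1)) * (SL + L + θ₀)) := by
  rw [inv_mul_eq_iff_eq_mul₀ hB, ← mul_right_inj' hD, h]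
  field_simp
  ring

theorem corollary2
    {Ω T X : Type*} [MeasurableSpace Ω]
    [MeasurableSpace T] [StandardBorelSpace T] [MeasurableSpace X] [StandardBorelSpace X]
    {N d : ℕ} (μ : Measure Ω) [IsProbabilityMeasure μ]
    (lay : Fin N → Fin d) (θ θ₀ : ℝ) (hθ : 0 < θ) (hθ₀ : 0 < θ₀)
    (G : Fin d → Measure T) [∀ j, IsProbabilityMeasure (G j)] [∀ j, NullSingletonClass (G j)]
    (P₀ : Measure X) [IsProbabilityMeasure P₀] [NullSingletonClass P₀]
    (Q : Fin d → Kernel Ω T) [∀ j, IsMarkovKernel (Q j)]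
    (P : Kernel Ω X) [IsMarkovKernel P]
    (t : Fin N → Ω → T) (s : Fin d × ℕ → Ω → X)
    (hscheme : IsHDPScheme μ lay θ θ₀ G P₀ Q P t s)
    (z w : Ω → Fin N → ℕ)
    (hz : ∀ ω, z ω = groupAlloc lay (fun a => t a ω) (fun p => s p ω))
    (hw : ∀ ω, w ω = subgroupAlloc lay (fun a => t a ω))
    (v u : Fin N) (hvu : v ≠ u)
    -- a value of the pair of reduced allocation vectors that has positive probability
    (ζ ϖ : others v u → ℕ)
    (hpos : μ {ω | removeZ v u (z ω) = ζ ∧ removeW lay v u (w ω) = ϖ} ≠ 0)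
    (n : Fin d → ℕ → ℝ) (hn : ∀ j h, n j h = (nodeCount lay ζ j h : ℝ))
    (ℓ : ℕ → ℝ) (hℓ : ∀ h, ℓ h = (subgroupTotal lay ζ ϖ h : ℝ))
    (L : ℝ) (hL : L = (subgroupCard lay ζ ϖ : ℝ))
    (V : Fin d → ℝ) (hV : ∀ j, V j = (layerSize lay j : ℝ))
    (H : ℕ) (hH : H = numGroups ζ) :
    (∀ j, lay v = j → lay u = j →
      (μ[|{ω | removeZ v u (z ω) = ζ ∧ removeW lay v u (w ω) = ϖ}]).real {ω | z ω v = z ω u} =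
        1 / ((θ + V j - 2) * (θ + V j - 1)) *
          (∑ h ∈ Finset.Icc 1 H, n j h * (n j h + 1)
            + θ * (1 + 2 / (θ₀ + L) * ∑ h ∈ Finset.Icc 1 H, n j h * ℓ h)
            + θ ^ 2 / ((θ₀ + L) * (θ₀ + L + 1)) *
                (∑ h ∈ Finset.Icc 1 H, ℓ h * (ℓ h + 1) + θ₀))) ∧
    (∀ j j', lay v = j → lay u = j' → j ≠ j' →
      (μ[|{ω | removeZ v u (z ω) = ζ ∧ removeW lay v u (w ω) = ϖ}]).real {ω | z ω v = z ω u} =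
        1 / ((θ + V j - 1) * (θ + V j' - 1)) *
          (∑ h ∈ Finset.Icc 1 H, n j h * n j' h
            + θ / (θ₀ + L) * ∑ h ∈ Finset.Icc 1 H, ℓ h * (n j h + n j' h)
            + θ ^ 2 / ((θ₀ + L) * (θ₀ + L + 1)) *
                (∑ h ∈ Finset.Icc 1 H, ℓ h * (ℓ h + 1) + θ₀))) := by
  lift θ to NNReal using hθ.le
  lift θ₀ to NNReal using hθ₀.le
  have hΘ : θ ≠ 0 := by simpa using hθ.ne'
  have hΘ₀ : θ₀ ≠ 0 := by simpa using hθ₀.ne'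
  -- Positive probability yields an outcome realizing (ζ, ϖ), which makes both genuine
  -- order-of-appearance labellings with subgroups nested in groups.
  obtain ⟨ω₀, hω₀z, hω₀w⟩ := nonempty_of_measure_ne_zero hpos
  rw [hz] at hω₀z
  rw [hw] at hω₀w
  set E : Set ((Fin N → T) × (Fin d × ℕ → X)) := {p | p.1 ∈ subgroupPattern T lay ϖ ∧
    p.2 ∈ tiePattern X (fun a : others v u => subgroupIndex lay p.1 a) ζ} with hE
  have hR : {ω | removeZ v u (z ω) = ζ ∧ removeW lay v u (w ω) = ϖ}
      = {ω | ((fun a => t a ω), fun p => s p ω) ∈ E} := by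
    ext ω
    simp only [Set.mem_ofPred_eq, hz, hw, removeZ_eq_iff hω₀z, removeW_eq_iff hω₀w, hE]
    exact and_comm
  have hζϖ : ∀ a b : others v u, (lay a, ϖ a) = (lay b, ϖ b) → ζ a = ζ b := by
    intro a b hab
    obtain ⟨hl, hϖ⟩ := Prod.mk.injEq _ _ _ _ ▸ hab
    have h1 := (removeW_eq_iff hω₀w _).1 hω₀w a b hl
    have h2 := (removeZ_eq_iff hω₀z _ _).1 hω₀z a b
    exact h2.1 (congrArg (fun i => s i ω₀)
      ((subgroupIndex_eq_iff (fun a => t a ω₀) a b).2 ⟨hl, h1.2 hϖ⟩))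
  have hζ : ∀ a, ζ a ∈ Finset.Icc 1 (numGroups ζ) := by
    rw [← hω₀z]
    exact removeZ_mem_Icc _
  let ζ' : Fin N → ℕ := fun a => if ha : a ∈ others v u then ζ ⟨a, ha⟩ else 0
  have hζ' : ∀ a : others v u, ζ' a = ζ a := fun a => dif_pos a.2
  have key := hscheme.measure_pattern_tie hΘ hΘ₀ hvu hζϖ hζ hE (fun _ => rfl) rfl hζ'
  have hEm : MeasurableSet {ω | ((fun a => t a ω), fun p => s p ω) ∈ E} := by
    have ht : Measurable fun ω a => t a ω :=
      measurable_pi_lambda _ fun a => (hscheme.subgroups (lay a)).measurable ⟨a, rfl⟩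
    have hs : Measurable fun ω p => s p ω := measurable_pi_lambda _ hscheme.profiles.measurable
    exact (ht.prodMk hs) (measurableSet_tie_event ζ ϖ)
  rw [hR] at hpos ⊢
  have hcond : (μ[|{ω | ((fun a => t a ω), fun p => s p ω) ∈ E}]).real {ω | z ω v = z ω u}
      = (μ {ω | ((fun a => t a ω), fun p => s p ω) ∈ E}).toReal⁻¹ *
        (μ {ω | ((fun a => t a ω), fun p => s p ω) ∈ E ∧
          s (subgroupIndex lay (fun a => t a ω) v) ω
            = s (subgroupIndex lay (fun a => t a ω) u) ω}).toReal := by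
    rw [measureReal_def, cond_apply hEm, ENNReal.toReal_mul, ENNReal.toReal_inv]
    congr 3
    ext ω
    simp only [Set.mem_inter_iff, Set.mem_ofPred_eq, hz, groupAlloc_eq_iff]
  rw [hcond]
  have hB : (μ {ω | ((fun a => t a ω), fun p => s p ω) ∈ E}).toReal ≠ 0 :=
    ENNReal.toReal_ne_zero.2 ⟨hpos, measure_ne_top _ _⟩
  have hn₁ : ∀ j, ∑ a ∈ (others v u).filter (fun a => lay a = j),
      ((subgroupTotal lay ζ ϖ (ζ' a) : NNReal) / (θ₀ + subgroupCard lay ζ ϖ))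
      = ∑ k ∈ Finset.Icc 1 (numGroups ζ), (nodeCount lay ζ j k : NNReal) *
        ((subgroupTotal lay ζ ϖ k : NNReal) / (θ₀ + subgroupCard lay ζ ϖ)) := fun j =>
    sum_layer_eq_sum_nodeCount lay hζ hζ' j
      fun k => (subgroupTotal lay ζ ϖ k : NNReal) / (θ₀ + subgroupCard lay ζ ϖ)
  have hn₂ : ∀ j j', ∑ b ∈ (others v u).filter (fun a => lay a = j'),
      ∑ a ∈ (others v u).filter (fun a => lay a = j), (if ζ' a = ζ' b then 1 else 0 : NNReal)
      = ∑ k ∈ Finset.Icc 1 (numGroups ζ), (nodeCount lay ζ j' k : NNReal) *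
        nodeCount lay ζ j k := by
    intro j j'
    rw [sum_layer_eq_sum_nodeCount lay hζ hζ' j' fun k =>
      ∑ a ∈ (others v u).filter (fun a => lay a = j), (if ζ' a = k then 1 else 0 : NNReal)]
    refine Finset.sum_congr rfl fun k hk => ?_
    rw [sum_layer_eq_sum_nodeCount lay hζ hζ' j fun l => (if l = k then 1 else 0 : NNReal)]
    simp [hk]
  have hn₃ : ∀ j, (((others v u).filter fun a => lay a = j).card : ℝ)
      = ∑ k ∈ Finset.Icc 1 (numGroups ζ), n j k := by
    intro j
    have := sum_layer_eq_sum_nodeCount lay hζ hζ' j fun _ => (1 : ℝ)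
    simpa [hn] using this
  have hV' : ∀ j, V j = ((others v u).filter fun a => lay a = j).card +
      (if lay v = j then 1 else 0) + if lay u = j then 1 else 0 := by
    intro j
    rw [hV, layerSize_eq_card_others lay hvu]
    push_cast
    rfl
  have hL' : L = ∑ k ∈ Finset.Icc 1 (numGroups ζ), ℓ k := by
    rw [hL, subgroupCard_eq_sum]
    push_cast
    simp only [hℓ]
  have hℓ2 : ∑ k ∈ Finset.Icc 1 (numGroups ζ), ℓ k * (ℓ k + 1)
      = ∑ k ∈ Finset.Icc 1 (numGroups ζ), ℓ k * ℓ k + L := by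
    rw [hL', ← Finset.sum_add_distrib]
    exact Finset.sum_congr rfl fun k _ => by ring
  have hLnn : 0 ≤ L := by
    rw [hL]
    exact Nat.cast_nonneg _
  have hr : 0 < (θ₀ : ℝ) + L := add_pos_of_pos_of_nonneg hθ₀ hLnn
  have hr' : 0 < (θ₀ : ℝ) + L + 1 := add_pos hr one_pos
  simp only [hn₁, hn₂] at key
  have key' := congrArg ENNReal.toReal key
  rw [ENNReal.toReal_mul, ENNReal.toReal_mul, ENNReal.coe_toReal, ENNReal.coe_toReal] at key'
  set A := (μ {ω | ((fun a => t a ω), fun p => s p ω) ∈ E ∧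
          s (subgroupIndex lay (fun a => t a ω) v) ω
            = s (subgroupIndex lay (fun a => t a ω) u) ω}).toReal
  set B := (μ {ω | ((fun a => t a ω), fun p => s p ω) ∈ E}).toReal
  have hdiv : ∀ j, ∑ k ∈ Finset.Icc 1 (numGroups ζ), n j k * (ℓ k / (θ₀ + L))
      = (∑ k ∈ Finset.Icc 1 (numGroups ζ), n j k * ℓ k) / (θ₀ + L) := fun j => by
    rw [Finset.sum_div]
    exact Finset.sum_congr rfl fun k _ => by ring
  have hcard : ∀ j, (0 : ℝ) ≤ ((others v u).filter fun a => lay a = j).card := fun j =>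
    Nat.cast_nonneg _
  subst hH
  constructor
  · rintro j rfl hl
    simp only [hl, if_true] at key'
    push_cast at key'
    simp only [← hn, ← hℓ, ← hL, hdiv] at key'
    have hVj := hV' (lay v)
    simp only [hl, if_true] at hVj
    have hsum : ∑ k ∈ Finset.Icc 1 (numGroups ζ), n (lay v) k * (n (lay v) k + 1)
        = ∑ k ∈ Finset.Icc 1 (numGroups ζ), n (lay v) k * n (lay v) k +
          ((others v u).filter fun a => lay a = lay v).card := by
      rw [hn₃, ← Finset.sum_add_distrib]
      exact Finset.sum_congr rfl fun k _ => by ring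
    have hc := hcard (lay v)
    -- V_j counts both v and u here, so V_j - 2 is the number of other nodes in the layer, and V_j -
    -- 1 adds back v for the draw of u.
    rw [show (θ : ℝ) + V (lay v) - 2 = θ + ((others v u).filter fun a => lay a = lay v).card by
        rw [hVj]; ring,
      show (θ : ℝ) + V (lay v) - 1 = θ + (((others v u).filter fun a => lay a = lay v).card + 1) by
        rw [hVj]; ring, hsum, hℓ2]
    exact inv_mul_eq_of_mul_eq_same_layer (mul_pos (add_pos_of_pos_of_nonneg hθ hc)
      (add_pos_of_pos_of_nonneg hθ (add_nonneg hc zero_le_one))).ne' hr.ne' hr'.ne' hB key'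
  · rintro j j' rfl rfl hl
    simp only [hl, if_false] at key'
    push_cast at key'
    simp only [← hn, ← hℓ, ← hL, hdiv] at key'
    have hVv := hV' (lay v)
    have hVu := hV' (lay u)
    simp only [hl, Ne.symm hl, if_true, if_false] at hVv hVu
    have hsum : ∑ k ∈ Finset.Icc 1 (numGroups ζ), ℓ k * (n (lay v) k + n (lay u) k)
        = ∑ k ∈ Finset.Icc 1 (numGroups ζ), n (lay v) k * ℓ k +
          ∑ k ∈ Finset.Icc 1 (numGroups ζ), n (lay u) k * ℓ k := by
      rw [← Finset.sum_add_distrib]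
      exact Finset.sum_congr rfl fun k _ => by ring
    have hcomm : ∑ k ∈ Finset.Icc 1 (numGroups ζ), n (lay v) k * n (lay u) k
        = ∑ k ∈ Finset.Icc 1 (numGroups ζ), n (lay u) k * n (lay v) k :=
      Finset.sum_congr rfl fun k _ => mul_comm _ _
    have hcv := hcard (lay v)
    have hcu := hcard (lay u)
    rw [show (θ : ℝ) + V (lay v) - 1 = θ + ((others v u).filter fun a => lay a = lay v).card by
        rw [hVv]; ring,
      show (θ : ℝ) + V (lay u) - 1 = θ + (((others v u).filter fun a => lay a = lay u).card + 0) by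
        rw [hVu]; ring, hsum, hℓ2, hcomm]
    exact inv_mul_eq_of_mul_eq_distinct_layers (mul_pos (add_pos_of_pos_of_nonneg hθ hcv)
      (add_pos_of_pos_of_nonneg hθ (add_nonneg hcu le_rfl))).ne' hr.ne' hr'.ne' hB key'
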